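/- A Bol loop is a loop $Q$ (a set with a binary operation having a two-sided identity element and in which $ac=b$ and $da=b$ have unique solutions $c,d\in Q$ for all $a,b\in Q$) that satisfies $((ca)b)a=c((ab)a)$ for all $a,b,c\in Q$ (right Bol) or satisfies $a(b(ac))=(a(ba))c$ for all $a,b,c\in Q$ (left Bol). For a Latin square $L$ with rows and columns indexed by $I$, let $X(L)=\{(r,c,L(r,c)) : r,c\in I\}$. Let $A_0,\dots,A_4$ be the $0/1$ complex matrices with rows and columns indexed by $X(L)$ whose $(x,x')$-entry is $1$ exactly when $x$ and $x'$ agree in all three components ($A_0$), only in the first ($A_1$), only in the second ($A_2$), only in the third ($A_3$), or in no component ($A_4$). For a base point $p\in X(L)$ let $E^*_i$ be the diagonal matrix whose $(x,x)$-entry is the $(p,x)$-entry of $A_i$. The Terwilliger algebra of $L$ with respect to $p$ is the complex matrix algebra generated by $A_0,\dots,A_4,E^*_0,\dots,E^*_4$. A Latin square $L$ is isotopic to $L'$ if $L'$ is obtained from $L$ by bijectively relabelling rows, columns and symbols; a conjugate of a Latin square $L'$ with rows, columns and symbols labelled by one set is a Latin square $M$ with $X(M)=\sigma(X(L'))$,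 where $\sigma\in\mathrm{Sym}(3)$ permutes the three components of triples; $L$ is main class equivalent to $L'$ if $L$ is isotopic to a conjugate of $L'$. **Corollary.** Let $L$ be any Latin square that is main class equivalent to the Cayley table of a finite Bol loop of order at least $5$. Then for every base point $p\in X(L)$ the Terwilliger algebra of $L$ with respect to $p$ is isomorphic, as a complex algebra, to $$\mathbb{M}_5\oplus\mathbb{M}_6\oplus\mathbb{M}_1\qquad\text{or to}\qquad \mathbb{M}_5\oplus\mathbb{M}_6\oplus\mathbb{M}_6\oplus\mathbb{M}_1,$$ where $\mathbb{M}_\ell$ is the algebra of all complex $\ell\times\ell$ matrices. -/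

import Mathlib

/-- A Latin square with rows and columns indexed by `I` and symbols in `S`: every symbol occurs
exactly once in each row and exactly once in each column. -/
structure LatinSquare (I : Type*) (S : Type*) where
  /-- The entry in a given row and column. -/
  entry : I → I → S
  row_existsUnique : ∀ (r : I) (s : S), ∃! c : I, entry r c = s
  col_existsUnique : ∀ (c : I) (s : S), ∃! r : I, entry r c = s

namespace LatinSquare

/-- The orthogonal array `X(L) = {(r, c, L(r, c))}`. -/
def orthogonalArray {I S : Type*} (L : LatinSquare I S) : Set (I × I × S) :=
  {x | ∃ r c : I, x = (r, c, L.entry r c)}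

/-- The points of the orthogonal array, as a type. -/
def Point {I S : Type*} (L : LatinSquare I S) : Type _ := {x : I × I × S // x ∈ L.orthogonalArray}

namespace Point

variable {I S : Type*} {L : LatinSquare I S}

/-- First component. -/
def row (x : L.Point) : I := x.1.1

/-- Second component. -/
def col (x : L.Point) : I := x.1.2.1

/-- Third component. -/
def sym (x : L.Point) : S := x.1.2.2

end Point

instance {I S : Type*} [Finite I] (L : LatinSquare I S) : Finite L.Point :=
  Finite.of_surjective
    (fun rc : I × I => (⟨(rc.1, rc.2, L.entry rc.1 rc.2), rc.1, rc.2, rfl⟩ : L.Point))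
    (by rintro ⟨_, r, c, rfl⟩; exact ⟨(r, c), rfl⟩)

noncomputable instance {I S : Type*} [Finite I] (L : LatinSquare I S) : Fintype L.Point :=
  Fintype.ofFinite _

noncomputable instance {I S : Type*} (L : LatinSquare I S) : DecidableEq L.Point :=
  Classical.decEq _

/-- The five relations of the association scheme of `L`: two points agree in all components,
only in the first, only in the second, only in the third, or in none. -/
def Related {I S : Type*} (L : LatinSquare I S) (i : Fin 5) (x y : L.Point) : Prop :=
  match i with
  | 0 => x.row = y.row ∧ x.col = y.col ∧ x.sym = y.sym
  | 1 => x.row = y.row ∧ x.col ≠ y.col ∧ x.sym ≠ y.sym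
  | 2 => x.row ≠ y.row ∧ x.col = y.col ∧ x.sym ≠ y.sym
  | 3 => x.row ≠ y.row ∧ x.col ≠ y.col ∧ x.sym = y.sym
  | 4 => x.row ≠ y.row ∧ x.col ≠ y.col ∧ x.sym ≠ y.sym

open scoped Classical in
/-- The relation matrices `A₀, …, A₄`. -/
noncomputable def relationMatrix {I S : Type*} (L : LatinSquare I S) (i : Fin 5) :
    Matrix L.Point L.Point ℂ :=
  Matrix.of fun x y => if L.Related i x y then 1 else 0

/-- The dual idempotents `E*₀, …, E*₄` with respect to the base point `p`. -/
noncomputable def dualIdempotent {I S : Type*} (L : LatinSquare I S) (p : L.Point) (i : Fin 5) :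
    Matrix L.Point L.Point ℂ :=
  Matrix.diagonal fun x => L.relationMatrix i p x

/-- The Terwilliger (subconstituent) algebra of `L` with respect to the base point `p`. -/
noncomputable def terwilligerAlgebra {I S : Type*} [Finite I] (L : LatinSquare I S) (p : L.Point) :
    Subalgebra ℂ (Matrix L.Point L.Point ℂ) :=
  Algebra.adjoin ℂ (Set.range L.relationMatrix ∪ Set.range (L.dualIdempotent p))

/-- `L'` is obtained from `L` by permuting (or relabelling bijectively) the rows, the columns
and the symbols. -/
def Isotopic {I S I' S' : Type*} (L : LatinSquare I S) (L' : LatinSquare I' S') : Prop :=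
  ∃ (σr : I ≃ I') (σc : I ≃ I') (σe : S ≃ S'),
    ∀ r c : I, L'.entry (σr r) (σc c) = σe (L.entry r c)

/-- The components of a triple over a single set, as a function on `Fin 3`. -/
def components {J : Type*} (x : J × J × J) : Fin 3 → J := ![x.1, x.2.1, x.2.2]

/-- Permute the components of a triple: component `i` is moved to component `σ i`. -/
def permuteTriple {J : Type*} (σ : Equiv.Perm (Fin 3)) (x : J × J × J) : J × J × J :=
  (components x (σ.symm 0), components x (σ.symm 1), components x (σ.symm 2))

/-- Conjugacy of Latin squares whose rows, columns and symbols are labelled by one set `J`: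
`X(M) = σ(X(L))` for some permutation `σ` of the three components. -/
def Conjugate {J : Type*} (L M : LatinSquare J J) : Prop :=
  ∃ σ : Equiv.Perm (Fin 3), M.orthogonalArray = permuteTriple σ '' L.orthogonalArray

/-- `L` is main class equivalent to `L'`: `L` is isotopic to a conjugate of `L'`. -/
def MainClassEquivalent {I S J : Type*} (L : LatinSquare I S) (L' : LatinSquare J J) : Prop :=
  ∃ M : LatinSquare J J, Conjugate L' M ∧ Isotopic L M

end LatinSquare

/-- A quasigroup: `a * c = b` and `d * a = b` are uniquely solvable. -/
structure IsQuasigroup (Q : Type*) [Mul Q] : Prop where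
  existsUnique_right : ∀ a b : Q, ∃! c : Q, a * c = b
  existsUnique_left : ∀ a b : Q, ∃! d : Q, d * a = b

/-- A loop: a quasigroup with a two-sided identity element. -/
structure IsLoop (Q : Type*) [Mul Q] : Prop extends IsQuasigroup Q where
  exists_identity : ∃ e : Q, ∀ a : Q, a * e = a ∧ e * a = a

/-- The right Bol axiom. -/
def RightBolAxiom (Q : Type*) [Mul Q] : Prop :=
  ∀ a b c : Q, ((c * a) * b) * a = c * ((a * b) * a)

/-- The left Bol axiom. -/
def LeftBolAxiom (Q : Type*) [Mul Q] : Prop :=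
  ∀ a b c : Q, a * (b * (a * c)) = (a * (b * a)) * c

/-- A Bol loop: a loop that is right Bol or left Bol. -/
structure IsBolLoop (Q : Type*) [Mul Q] : Prop extends IsLoop Q where
  bol : RightBolAxiom Q ∨ LeftBolAxiom Q

/-- The Cayley table of a quasigroup: the `(a, b)`-entry is `a * b`. -/
def cayleyTable {Q : Type*} [Mul Q] (hQ : IsQuasigroup Q) : LatinSquare Q Q where
  entry a b := a * b
  row_existsUnique a b := hQ.existsUnique_right a b
  col_existsUnique a b := hQ.existsUnique_left a b

/-! The Bol identity enters only through the hexagon condition (`IsBolLoop.hexagonal`). This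
condition treats the three parallel classes of a Latin square alike, so it survives conjugation and
isotopy. Around a base point, label the three lines through it by the `n` symbols. Transferring
labels along the parallel classes identifies these lines up to a single permutation `inv` of the
symbols, and the hexagon condition makes `inv` an involution fixing the label `e` of the base point
(`LatinSquare.loopNet`).

There are six incidence matrices `F` from symbols to points: three for the labelled lines through
the base point, three for the parallel classes. The products `F * Fᵀ` generate the Terwilliger
algebra (`LatinSquare.terwilligerAlgebra_eq_incAlgebra`). The products `Fᵀ * F'` involve only the
identity, `inv`, constant vectors and vectors concentrated at `e`. Hence they act as scalars on the
symbol vectors with sum zero that vanish at `e` and lie in one eigenspace of `inv`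
(`LoopNet.IsEigen.inc_mul`). With `P` the projection onto such an eigenspace, the matrices `F * P *
F'ᵀ` multiply like matrix units twisted by a Gram matrix of size six, invertible for `n ≥ 5`
(`LoopNet.isUnit_det_gram`), so they span a copy of the full matrix algebra of size six.

The remaining symbol vectors, spanned by `delta` and `codelta`, are sent into the span of the five
class vectors, which yields the block of size five. On the complement of all these images the
algebra acts by scalars, and a trace count gives that complement dimension `n² - 6n + 7 > 0`: the
block of size one. The even eigenspace is never zero, and the odd one is zero exactly when `inv` is
the identity; this is the alternative in the theorem. -/

set_option linter.unusedSectionVars false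

/-! ### Full matrix algebras from matrix units twisted by a Gram matrix -/

section GramHom

variable {R α : Type*} [Ring R] [Algebra ℂ R] [Fintype α]

/-- The linear map sending the matrix unit `(a, b)` to `u a b`. -/
noncomputable def unitsLift (u : α → α → R) : Matrix α α ℂ →ₗ[ℂ] R where
  toFun M := ∑ a, ∑ b, M a b • u a b
  map_add' M N := by simp [add_smul, Finset.sum_add_distrib]
  map_smul' c M := by simp [Finset.smul_sum, mul_smul]

lemma unitsLift_apply (u : α → α → R) (M : Matrix α α ℂ) :
    unitsLift u M = ∑ a, ∑ b, M a b • u a b := rfl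

lemma unitsLift_single [DecidableEq α] (u : α → α → R) (a b : α) (c : ℂ) :
    unitsLift u (Matrix.single a b c) = c • u a b := by
  rw [unitsLift_apply, Finset.sum_eq_single a, Finset.sum_eq_single b]
  · simp
  · intro b' _ hb; simp [Matrix.single, hb.symm]
  · simp
  · intro a' _ ha; simp [Matrix.single, ha.symm]
  · simp

lemma unitsLift_mul {u : α → α → R} {G : Matrix α α ℂ}
    (hu : ∀ a b c d, u a b * u c d = G b c • u a d) (M N : Matrix α α ℂ) :
    unitsLift u M * unitsLift u N = unitsLift u (M * G * N) := by
  simp only [unitsLift_apply, Finset.sum_mul, Finset.mul_sum, smul_mul_smul_comm, hu,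
    Matrix.mul_apply, Finset.sum_smul, smul_smul]
  rw [Finset.sum_congr rfl fun c _ => Finset.sum_comm, Finset.sum_comm]
  refine Finset.sum_congr rfl fun a _ => ?_
  rw [Finset.sum_comm]
  refine Finset.sum_congr rfl fun d _ => Finset.sum_congr rfl fun c _ =>
    Finset.sum_congr rfl fun b _ => ?_
  rw [mul_right_comm]

/-- Multiplying the image of `M` by `u a₀ c` on the left and `u d b₀` on the right gives the `(c,
d)` entry of `G * M * G` times `u a₀ b₀`. One nonzero unit therefore suffices to recover `M`. -/
lemma unitsLift_injective [DecidableEq α] {u : α → α → R} {G : Matrix α α ℂ} (hG : IsUnit G.det)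
    (hu : ∀ a b c d, u a b * u c d = G b c • u a d) {a₀ b₀ : α} (h₀ : u a₀ b₀ ≠ 0) :
    Function.Injective (unitsLift u) := by
  rw [injective_iff_map_eq_zero]
  intro M hM
  have key : G * M * G = 0 := by
    ext c d
    have h : unitsLift u (Matrix.single a₀ c 1) * unitsLift u M *
        unitsLift u (Matrix.single d b₀ 1) = ((G * M * G) c d) • u a₀ b₀ := by
      rw [unitsLift_mul hu, unitsLift_mul hu, ← unitsLift_single]
      congr 1
      have : Matrix.single a₀ c (1 : ℂ) * G * M * G * Matrix.single d b₀ 1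
          = Matrix.single a₀ c (1 : ℂ) * (G * M * G) * Matrix.single d b₀ 1 := by
        simp only [Matrix.mul_assoc]
      rw [this, Matrix.single_mul_mul_single]
      simp
    rw [hM, mul_zero, zero_mul] at h
    simpa using (smul_eq_zero.mp h.symm).resolve_right h₀
  have h2 : G⁻¹ * (G * M * G) * G⁻¹ = M := by
    rw [Matrix.mul_assoc G, Matrix.nonsing_inv_mul_cancel_left _ _ hG,
      Matrix.mul_nonsing_inv_cancel_right _ _ hG]
  rw [← h2, key]; simp

/-- The multiplicative map attached to a system `u` with `u a b * u c d = G b c • u a d`. -/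
noncomputable def gramHom [DecidableEq α] (G : Matrix α α ℂ) (u : α → α → R) : Matrix α α ℂ →ₗ[ℂ] R :=
  unitsLift u ∘ₗ LinearMap.mulRight ℂ G⁻¹

variable [DecidableEq α]

lemma gramHom_apply (G : Matrix α α ℂ) (u : α → α → R) (M : Matrix α α ℂ) :
    gramHom G u M = unitsLift u (M * G⁻¹) := rfl

/-- The factor `G⁻¹` in `gramHom` absorbs the `G` that `unitsLift_mul` inserts between two factors.
-/
lemma gramHom_mul {u : α → α → R} {G : Matrix α α ℂ} (hG : IsUnit G.det)
    (hu : ∀ a b c d, u a b * u c d = G b c • u a d) (M N : Matrix α α ℂ) :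
    gramHom G u (M * N) = gramHom G u M * gramHom G u N := by
  simp only [gramHom_apply]
  rw [unitsLift_mul hu, Matrix.nonsing_inv_mul_cancel_right _ _ hG, Matrix.mul_assoc]

lemma gramHom_injective {u : α → α → R} {G : Matrix α α ℂ} (hG : IsUnit G.det)
    (hu : ∀ a b c d, u a b * u c d = G b c • u a d) {a₀ b₀ : α} (h₀ : u a₀ b₀ ≠ 0) :
    Function.Injective (gramHom G u) := by
  refine (unitsLift_injective hG hu h₀).comp fun M N h => ?_
  simpa [Matrix.nonsing_inv_mul_cancel_right _ _ hG] using congrArg (· * G) h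

lemma mem_range_gramHom {u : α → α → R} {G : Matrix α α ℂ} (hG : IsUnit G.det) (a b : α) :
    u a b ∈ LinearMap.range (gramHom G u) :=
  ⟨Matrix.single a b 1 * G, by
    rw [gramHom_apply, Matrix.mul_nonsing_inv_cancel_right _ _ hG, unitsLift_single, one_smul]⟩

lemma gramHom_mem {u : α → α → R} {G : Matrix α α ℂ} {T : Submodule ℂ R}
    (h : ∀ a b, u a b ∈ T) (M : Matrix α α ℂ) : gramHom G u M ∈ T :=
  Submodule.sum_mem _ fun a _ => Submodule.sum_mem _ fun b _ => T.smul_mem _ (h a b)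

lemma gramHom_mul_eq_zero {β : Type*} [Fintype β] [DecidableEq β] {G : Matrix α α ℂ}
    {H : Matrix β β ℂ} {u : α → α → R} {v : β → β → R} (h : ∀ a b c d, u a b * v c d = 0)
    (M : Matrix α α ℂ) (N : Matrix β β ℂ) : gramHom G u M * gramHom H v N = 0 := by
  simp [gramHom_apply, unitsLift_apply, Finset.sum_mul, Finset.mul_sum, h]

end GramHom

/-! ### Gluing mutually annihilating blocks -/

section Coprod

variable {R A B : Type*} [Ring R] [Algebra ℂ R] [Ring A] [Algebra ℂ A] [Ring B] [Algebra ℂ B]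
  {f : A →ₗ[ℂ] R} {g : B →ₗ[ℂ] R}

lemma coprod_map_mul (hf : ∀ x y, f (x * y) = f x * f y) (hg : ∀ x y, g (x * y) = g x * g y)
    (hfg : ∀ x y, f x * g y = 0) (hgf : ∀ x y, g y * f x = 0) (x y : A × B) :
    f.coprod g (x * y) = f.coprod g x * f.coprod g y := by
  simp [LinearMap.coprod_apply, hf, hg, add_mul, mul_add, hfg, hgf]

lemma coprod_injective (hf : ∀ x y, f (x * y) = f x * f y) (hg : ∀ x y, g (x * y) = g x * g y)
    (hfg : ∀ x y, f x * g y = 0) (hgf : ∀ x y, g y * f x = 0) (hfi : Function.Injective f)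
    (hgi : Function.Injective g) : Function.Injective (f.coprod g) := by
  rw [injective_iff_map_eq_zero]
  rintro ⟨a, b⟩ h
  rw [LinearMap.coprod_apply] at h
  -- Multiplication by the identity of one block kills the other block.
  have h1 := congrArg (f 1 * ·) h
  have h2 := congrArg (g 1 * ·) h
  simp only [mul_add, ← hf, ← hg, hfg, hgf, one_mul, add_zero, zero_add, mul_zero] at h1 h2
  rw [map_eq_zero_iff f hfi] at h1
  rw [map_eq_zero_iff g hgi] at h2
  rw [h1, h2]; rfl

end Coprod

/-- The one-by-one block spanned by an idempotent. -/
noncomputable def idempotentHom {R : Type*} [Ring R] [Algebra ℂ R] (z : R) :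
    Matrix (Fin 1) (Fin 1) ℂ →ₗ[ℂ] R where
  toFun M := M 0 0 • z
  map_add' M N := by simp [add_smul]
  map_smul' c M := by simp [mul_smul]

lemma idempotentHom_apply {R : Type*} [Ring R] [Algebra ℂ R] (z : R)
    (M : Matrix (Fin 1) (Fin 1) ℂ) : idempotentHom z M = M 0 0 • z := rfl

lemma idempotentHom_mul {R : Type*} [Ring R] [Algebra ℂ R] {z : R} (hz : z * z = z)
    (M N : Matrix (Fin 1) (Fin 1) ℂ) :
    idempotentHom z (M * N) = idempotentHom z M * idempotentHom z N := by
  simp [idempotentHom_apply, Matrix.mul_apply, hz, smul_smul, mul_comm]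

lemma idempotentHom_injective {R : Type*} [Ring R] [Algebra ℂ R] {z : R} (hz : z ≠ 0) :
    Function.Injective (idempotentHom z) := by
  rw [injective_iff_map_eq_zero]
  intro M hM
  rw [idempotentHom_apply, smul_eq_zero, or_iff_left hz] at hM
  ext i j
  rw [Subsingleton.elim i 0, Subsingleton.elim j 0, hM]; rfl

/-- An injective unital multiplicative linear map onto a subalgebra is an algebra isomorphism. -/
lemma nonempty_algEquiv_of_linearMap {R A : Type*} [Ring R] [Algebra ℂ R] [Ring A] [Algebra ℂ A]
    {f : A →ₗ[ℂ] R} (hf1 : f 1 = 1) (hf : ∀ x y, f (x * y) = f x * f y)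
    (hfi : Function.Injective f) {T : Subalgebra ℂ R} (hle : ∀ x, f x ∈ T)
    (hge : ∀ 𝓡 : Subalgebra ℂ R, (∀ x, f x ∈ 𝓡) → T ≤ 𝓡) : Nonempty (T ≃ₐ[ℂ] A) := by
  let F : A →ₐ[ℂ] R := AlgHom.ofLinearMap f hf1 hf
  have hT : T = F.range := by
    refine le_antisymm (hge _ fun x => ⟨x, rfl⟩) ?_
    rintro _ ⟨x, rfl⟩
    exact hle x
  rw [hT]
  exact ⟨(AlgEquiv.ofInjective F hfi).symm⟩

/-! ### The net around a base point, in coordinates -/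

/-- Coordinates, with respect to a base point, of the points of a Latin square satisfying the
hexagon condition at that point.  The three coordinates `coord j` take values in the symbol set,
`base i s` is the point labelled `s` on the `i`-th line through the base point. -/
structure LoopNet (X S : Type*) where
  e : S
  inv : S → S
  coord : Fin 3 → X → S
  base : Fin 3 → S → X
  inv_inv : ∀ s, inv (inv s) = s
  coord_injective : ∀ i j, i ≠ j → ∀ x y, coord i x = coord i y → coord j x = coord j y → x = y
  coord_surjective : ∀ i j, i ≠ j → ∀ s t, ∃ x, coord i x = s ∧ coord j x = t
  coord_base : ∀ i j s, coord j (base i s) =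
    (![![fun _ => e, id, id], ![id, fun _ => e, id], ![id, inv, fun _ => e]] :
      Fin 3 → Fin 3 → S → S) i j s

namespace LoopNet

open Matrix

variable {X S : Type*} (N : LoopNet X S)

/-- The three lines meet in the base point, which carries the label `e` on each of them. -/
lemma base_e (i : Fin 3) : N.base i N.e = N.base 0 N.e := by
  fin_cases i
  · rfl
  · apply N.coord_injective 0 1 (by decide) <;> simp [N.coord_base]
  · apply N.coord_injective 0 2 (by decide) <;> simp [N.coord_base]

lemma coord_base_self (i : Fin 3) (s : S) : N.coord i (N.base i s) = N.e := by
  fin_cases i <;> simp [N.coord_base]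

lemma coord_base_e (i : Fin 3) : N.coord i (N.base 0 N.e) = N.e := by
  rw [← N.base_e i, N.coord_base_self]

lemma inv_e : N.inv N.e = N.e := by
  have h := N.coord_base_e 1
  rw [← N.base_e 2] at h
  simpa [N.coord_base] using h

lemma exists_base {i : Fin 3} {x : X} (h : N.coord i x = N.e) : ∃ s, x = N.base i s := by
  fin_cases i
  · exact ⟨N.coord 1 x, N.coord_injective 0 1 (by decide) _ _
      (by simpa [N.coord_base] using h) (by simp [N.coord_base])⟩
  · exact ⟨N.coord 0 x, N.coord_injective 0 1 (by decide) _ _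
      (by simp [N.coord_base]) (by simpa [N.coord_base] using h)⟩
  · exact ⟨N.coord 0 x, N.coord_injective 0 2 (by decide) _ _
      (by simp [N.coord_base]) (by simpa [N.coord_base] using h)⟩

lemma base_injective (i : Fin 3) : Function.Injective (N.base i) := by
  intro s t h
  fin_cases i
  · simpa [N.coord_base] using congrArg (N.coord 1) h
  · simpa [N.coord_base] using congrArg (N.coord 0) h
  · simpa [N.coord_base] using congrArg (N.coord 0) h

lemma eq_base_e {i j : Fin 3} (hij : i ≠ j) {x : X} (hi : N.coord i x = N.e)
    (hj : N.coord j x = N.e) : x = N.base 0 N.e :=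
  N.coord_injective i j hij _ _ (by rw [hi, N.coord_base_e]) (by rw [hj, N.coord_base_e])

lemma base_ne {i j : Fin 3} (hij : i ≠ j) {s t : S} (h : N.base i s = N.base j t) : t = N.e := by
  have h1 := N.coord_base_self i s
  rw [h] at h1
  have h2 := N.eq_base_e hij h1 (N.coord_base_self j t)
  rw [← N.base_e j] at h2
  exact N.base_injective j h2

/-- Two distinct coordinates identify the points with pairs of symbols. -/
noncomputable def pairEquiv {i j : Fin 3} (hij : i ≠ j) : X ≃ S × S :=
  Equiv.ofBijective (fun x => (N.coord i x, N.coord j x))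
    ⟨fun x y h => N.coord_injective i j hij x y (congrArg Prod.fst h) (congrArg Prod.snd h),
      fun st => let ⟨x, h⟩ := N.coord_surjective i j hij st.1 st.2; ⟨x, Prod.ext h.1 h.2⟩⟩

section Sums

variable [Fintype X] [Fintype S]

lemma sum_coord {i j : Fin 3} (hij : i ≠ j) (φ : S → S → ℂ) :
    ∑ x, φ (N.coord i x) (N.coord j x) = ∑ s, ∑ t, φ s t := by
  rw [← Fintype.sum_prod_type' (f := φ)]
  exact Fintype.sum_equiv (N.pairEquiv hij) _ _ fun x => rfl

lemma sum_coord_one (i : Fin 3) (φ : S → ℂ) :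
    ∑ x, φ (N.coord i x) = Fintype.card S * ∑ s, φ s := by
  obtain ⟨j, hj⟩ : ∃ j : Fin 3, i ≠ j := ⟨i + 1, by fin_cases i <;> decide⟩
  rw [N.sum_coord hj fun s _ => φ s]
  simp [Finset.mul_sum]

lemma card_points (N : LoopNet X S) : (Fintype.card X : ℂ) = (Fintype.card S : ℂ) ^ 2 := by
  have := N.sum_coord_one 0 fun _ => 1
  simpa [sq] using this

end Sums

/-! ### The Gram matrix of size six -/

/-- Scalars by which `baseMatrixᵀ * lineMatrix` acts. -/
def crossGram (lam : ℂ) : Matrix (Fin 3) (Fin 3) ℂ := !![0, 1, 1; 1, 0, 1; 1, lam, 0]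

/-- Gram matrix of the six incidence matrices. -/
noncomputable def gram (n : ℕ) (lam : ℂ) : Matrix (Fin 3 ⊕ Fin 3) (Fin 3 ⊕ Fin 3) ℂ :=
  fromBlocks 1 (crossGram lam) (crossGram lam)ᵀ ((n : ℂ) • 1)

/-- By the Schur complement, the determinant is that of `n • 1 - Cᵀ * C` with `C = crossGram lam`.
It equals `(n - 4) * (n - 1) ^ 2` for `lam = 1` and `n * (n - 3) ^ 2` for `lam = -1`, so order four
would fail in the even case. -/
lemma isUnit_det_gram {n : ℕ} (hn : 5 ≤ n) {lam : ℂ} (hl : lam = 1 ∨ lam = -1) :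
    IsUnit (gram n lam).det := by
  obtain ⟨k, rfl⟩ := Nat.exists_eq_add_of_le hn
  rw [gram, det_fromBlocks_one₁₁, isUnit_iff_ne_zero, det_fin_three]
  simp only [crossGram, Matrix.sub_apply, Matrix.mul_apply, Fin.sum_univ_three,
    Matrix.transpose_apply, Matrix.smul_apply, Matrix.one_apply]
  rcases hl with rfl | rfl
  · have h : (((k + 1) * (k + 4) ^ 2 : ℕ) : ℂ) ≠ 0 := by
      exact_mod_cast (by positivity : (k + 1) * (k + 4) ^ 2 ≠ 0)
    convert h using 1
    simp
    ring
  · have h : (((k + 5) * (k + 2) ^ 2 : ℕ) : ℂ) ≠ 0 := by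
      exact_mod_cast (by positivity : (k + 5) * (k + 2) ^ 2 ≠ 0)
    convert h using 1
    simp
    ring

/-! ### Eigenspaces of the inversion on symbol vectors -/

section Projections

variable [Fintype S] [DecidableEq S]

/-- The permutation matrix of the inversion. -/
def invMatrix : Matrix S S ℂ := of fun s t => if N.inv s = t then 1 else 0

/-- The columns of `P` have sum zero, vanish at `e`, and are eigenvectors of the inversion with
eigenvalue `lam`. -/
structure IsEigen (lam : ℂ) (P : Matrix S S ℂ) : Prop where
  sum_eq_zero : ∀ t, ∑ s, P s t = 0
  apply_e : ∀ t, P N.e t = 0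
  apply_inv : ∀ s t, P (N.inv s) t = lam * P s t

/-- The indicator vector of `e`. -/
def delta : S → ℂ := Pi.single N.e 1

/-- The indicator vector of the complement of `e`. -/
def codelta : S → ℂ := 1 - N.delta

/-- Projection onto the even vectors with sum zero that vanish at `e`. -/
noncomputable def evenProj : Matrix S S ℂ :=
  (1 / 2 : ℂ) • (1 + N.invMatrix) - vecMulVec N.delta N.delta
    - (1 / ((Fintype.card S : ℂ) - 1)) • vecMulVec N.codelta N.codelta

/-- Projection onto the odd vectors. -/
noncomputable def oddProj : Matrix S S ℂ := (1 / 2 : ℂ) • (1 - N.invMatrix)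

lemma invMatrix_transpose : N.invMatrixᵀ = N.invMatrix := by
  ext s t
  simp only [invMatrix, transpose_apply, of_apply]
  congr 1
  exact propext ⟨fun h => by rw [← h, N.inv_inv], fun h => by rw [← h, N.inv_inv]⟩

lemma evenProj_transpose : N.evenProjᵀ = N.evenProj := by
  simp [evenProj, transpose_vecMulVec, invMatrix_transpose]

lemma oddProj_transpose : N.oddProjᵀ = N.oddProj := by
  simp [oddProj, invMatrix_transpose]

lemma sum_invMatrix (t : S) : ∑ s, N.invMatrix s t = 1 := by
  have : ∀ s, N.invMatrix s t = N.invMatrix t s := fun s =>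
    congrFun (congrFun N.invMatrix_transpose t) s
  simp only [this]
  simp [invMatrix]

lemma sum_delta : ∑ s, N.delta s = 1 := by simp [delta]

lemma sum_codelta : ∑ s, N.codelta s = Fintype.card S - 1 := by
  simp [codelta, Finset.sum_sub_distrib, sum_delta]

/-- Symmetrizing projects onto all `inv`-invariant vectors. Among these, `delta` and `codelta` are
orthogonal of squared norm `1` and `n - 1`; removing their projections enforces value zero at `e`
and sum zero. -/
lemma isEigen_evenProj (hn : 5 ≤ Fintype.card S) : N.IsEigen 1 N.evenProj := by
  have hn' : (Fintype.card S : ℂ) - 1 ≠ 0 := by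
    rw [sub_ne_zero]; exact_mod_cast (by omega : Fintype.card S ≠ 1)
  have hinv : ∀ s, N.inv s = N.e ↔ s = N.e := fun s =>
    ⟨fun h => by rw [← N.inv_inv s, h, N.inv_e], fun h => by rw [h, N.inv_e]⟩
  have hd : ∀ s, N.delta (N.inv s) = N.delta s := fun s => by
    simp [delta, Pi.single_apply, hinv]
  refine ⟨fun t => ?_, fun t => ?_, fun s t => ?_⟩
  · simp only [evenProj, Matrix.sub_apply, Matrix.smul_apply, Matrix.add_apply, vecMulVec_apply,
      smul_eq_mul, Finset.sum_sub_distrib, ← Finset.mul_sum, Finset.sum_add_distrib,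
      sum_invMatrix, ← Finset.sum_mul, sum_delta, sum_codelta]
    simp only [Matrix.one_apply, Finset.sum_ite_eq', Finset.mem_univ, if_true]
    rw [← mul_assoc, one_div_mul_cancel hn']
    simp [codelta]; ring
  · simp only [evenProj, Matrix.sub_apply, Matrix.smul_apply, Matrix.add_apply, vecMulVec_apply,
      smul_eq_mul, codelta, delta, invMatrix, of_apply, N.inv_e, Matrix.one_apply]
    by_cases h : N.e = t
    · subst h; simp; norm_num
    · simp [h, Ne.symm h]
  · simp only [evenProj, Matrix.sub_apply, Matrix.smul_apply, Matrix.add_apply, vecMulVec_apply,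
      smul_eq_mul, codelta, Pi.sub_apply, hd, invMatrix, of_apply, N.inv_inv, Matrix.one_apply,
      Pi.one_apply]
    ring

lemma isEigen_oddProj : N.IsEigen (-1) N.oddProj := by
  refine ⟨fun t => ?_, fun t => ?_, fun s t => ?_⟩
  · simp [oddProj, ← Finset.mul_sum, Finset.sum_sub_distrib, sum_invMatrix, Matrix.one_apply]
  · simp [oddProj, invMatrix, N.inv_e, Matrix.one_apply]
  · simp only [oddProj, Matrix.sub_apply, Matrix.smul_apply, smul_eq_mul, invMatrix, of_apply,
      N.inv_inv, Matrix.one_apply]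
    ring

section Eigen

variable {N} {lam : ℂ} {P : Matrix S S ℂ}


lemma IsEigen.invMatrix_mul (hP : N.IsEigen lam P) : N.invMatrix * P = lam • P := by
  ext s t
  simp [invMatrix, Matrix.mul_apply, hP.apply_inv]

lemma IsEigen.delta_vecMul (hP : N.IsEigen lam P) : N.delta ᵥ* P = 0 := by
  ext t
  simp [delta, hP.apply_e, Matrix.row_apply]

lemma IsEigen.one_vecMul (hP : N.IsEigen lam P) : (1 : S → ℂ) ᵥ* P = 0 := by
  ext t
  simp [vecMul, dotProduct, hP.sum_eq_zero]

lemma IsEigen.evenProj_mul (hP : N.IsEigen lam P) : N.evenProj * P = ((1 + lam) / 2) • P := by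
  have h : N.codelta ᵥ* P = 0 := by
    rw [codelta, sub_vecMul, hP.one_vecMul, hP.delta_vecMul, sub_zero]
  simp only [evenProj, Matrix.sub_mul, Matrix.smul_mul, Matrix.add_mul, Matrix.one_mul,
    vecMulVec_mul, h, hP.delta_vecMul, hP.invMatrix_mul, vecMulVec_zero, smul_zero, sub_zero]
  module

lemma IsEigen.oddProj_mul (hP : N.IsEigen lam P) : N.oddProj * P = ((1 - lam) / 2) • P := by
  simp only [oddProj, Matrix.sub_mul, Matrix.smul_mul, Matrix.one_mul, hP.invMatrix_mul]
  module

end Eigen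

end Projections

/-! ### The six incidence matrices -/

variable [DecidableEq X] [DecidableEq S]

/-- Incidence matrix between points and the labels of the `i`-th line through the base point. -/
def baseMatrix (i : Fin 3) : Matrix X S ℂ := of fun x s => if x = N.base i s then 1 else 0

/-- Incidence matrix between points and the lines of the `j`-th parallel class. -/
def lineMatrix (j : Fin 3) : Matrix X S ℂ := of fun x s => if N.coord j x = s then 1 else 0

/-- All six incidence matrices. -/
def inc : Fin 3 ⊕ Fin 3 → Matrix X S ℂ := Sum.elim N.baseMatrix N.lineMatrix

lemma baseMatrix_transpose_mul [Fintype X] {γ : Type*} (i : Fin 3) (M : Matrix X γ ℂ) :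
    (N.baseMatrix i)ᵀ * M = of fun s t => M (N.base i s) t := by
  ext s t
  simp [baseMatrix, Matrix.mul_apply]

lemma lineMatrix_mul [Fintype S] {γ : Type*} (j : Fin 3) (M : Matrix S γ ℂ) :
    N.lineMatrix j * M = of fun x t => M (N.coord j x) t := by
  ext s t
  simp [lineMatrix, Matrix.mul_apply]

variable [Fintype X] [Fintype S]

variable {N} in
-- Distinct lines through the base point share only the label `e`, where `P` vanishes. A coordinate
-- of a labelled point is `e`, the label or its inverse, giving `0`, `1` or `lam`. Lines of distinct
-- classes meet once, which produces column sums, hence zero; a class against itself gives `n`.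
lemma IsEigen.inc_mul {lam : ℂ} {P : Matrix S S ℂ} (hP : N.IsEigen lam P) (b c : Fin 3 ⊕ Fin 3) :
    (N.inc b)ᵀ * N.inc c * P = gram (Fintype.card S) lam b c • P := by
  rw [Matrix.mul_assoc]
  rcases b with i | i <;> rcases c with j | j
  · ext s t
    have h : ((N.baseMatrix i)ᵀ * (N.baseMatrix j * P)) s t
        = ∑ s', if N.base i s = N.base j s' then P s' t else 0 := by
      rw [baseMatrix_transpose_mul]
      simp [baseMatrix, Matrix.mul_apply]
    simp only [inc, Sum.elim_inl, h, gram, fromBlocks_apply₁₁, Matrix.smul_apply, smul_eq_mul]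
    by_cases hij : i = j
    · subst hij
      simp [(N.base_injective i).eq_iff]
    · rw [Matrix.one_apply_ne hij, zero_mul]
      refine Finset.sum_eq_zero fun s' _ => ?_
      split_ifs with h
      · rw [N.base_ne hij h, hP.apply_e]
      · rfl
  · ext s t
    simp only [inc, Sum.elim_inl, Sum.elim_inr, baseMatrix_transpose_mul, lineMatrix_mul, of_apply,
      gram, fromBlocks_apply₁₂, Matrix.smul_apply, smul_eq_mul, N.coord_base]
    fin_cases i <;> fin_cases j <;> simp [crossGram, hP.apply_e, hP.apply_inv]
  · ext s t
    have h : ((N.lineMatrix i)ᵀ * (N.baseMatrix j * P)) s t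
        = ∑ s', if N.coord i (N.base j s') = s then P s' t else 0 := by
      rw [← Matrix.mul_assoc]
      simp [lineMatrix, baseMatrix, Matrix.mul_apply]
    simp only [inc, Sum.elim_inl, Sum.elim_inr, h, gram, fromBlocks_apply₂₁, transpose_apply,
      Matrix.smul_apply, smul_eq_mul, N.coord_base]
    have h1 : ∀ s', N.inv s' = s ↔ s' = N.inv s := fun s' =>
      ⟨fun h => by rw [← h, N.inv_inv], fun h => by rw [h, N.inv_inv]⟩
    fin_cases i <;> fin_cases j <;>
      simp [crossGram, hP.apply_inv, h1, hP.sum_eq_zero, Finset.sum_ite_irrel]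
  · ext s t
    have h : ((N.lineMatrix i)ᵀ * (N.lineMatrix j * P)) s t
        = ∑ x, if N.coord i x = s then P (N.coord j x) t else 0 := by
      rw [lineMatrix_mul]
      simp [lineMatrix, Matrix.mul_apply]
    simp only [inc, Sum.elim_inr, h, gram, fromBlocks_apply₂₂, Matrix.smul_apply, smul_eq_mul]
    by_cases hij : i = j
    · subst hij
      rw [N.sum_coord_one i fun s' => if s' = s then P s' t else 0]
      simp
    · rw [N.sum_coord hij fun s' t' => if s' = s then P t' t else 0]
      simp [Finset.sum_ite_irrel, hP.sum_eq_zero, Matrix.one_apply_ne hij]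


end LoopNet

/-! ### Class vectors and the twisted matrix units of the blocks -/

namespace LoopNet

open Matrix

variable {X S : Type*} (N : LoopNet X S) [DecidableEq X] [DecidableEq S]

/-- The indicator vector of the base point. -/
def pointVec : X → ℂ := Pi.single (N.base 0 N.e) 1

/-- The indicator vector of the `i`-th line through the base point. -/
def lineVec (i : Fin 3) : X → ℂ := fun x => if N.coord i x = N.e then 1 else 0

/-- The indicator vectors of the five classes with respect to the base point. -/
def classVec : Fin 5 → X → ℂ :=
  ![N.pointVec, N.lineVec 0 - N.pointVec, N.lineVec 1 - N.pointVec, N.lineVec 2 - N.pointVec,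
    1 - N.lineVec 0 - N.lineVec 1 - N.lineVec 2 + (2 : ℂ) • N.pointVec]

/-- The sizes of the five classes. -/
def classSize (n : ℂ) : Fin 5 → ℂ := ![1, n - 1, n - 1, n - 1, (n - 1) * (n - 2)]

variable [Fintype X] [Fintype S]

lemma baseMatrix_transpose_mul_self (i : Fin 3) : (N.baseMatrix i)ᵀ * N.baseMatrix i = 1 := by
  rw [baseMatrix_transpose_mul]
  ext s t
  simp [baseMatrix, (N.base_injective i).eq_iff, Matrix.one_apply]

lemma baseMatrix_mulVec_delta (i : Fin 3) : N.baseMatrix i *ᵥ N.delta = N.pointVec := by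
  ext x
  simp [baseMatrix, delta, pointVec, N.base_e i, Pi.single_apply]

lemma baseMatrix_mulVec_one (i : Fin 3) : N.baseMatrix i *ᵥ 1 = N.lineVec i := by
  ext x
  simp only [mulVec, dotProduct, baseMatrix, of_apply, Pi.one_apply, mul_one, lineVec]
  split_ifs with h
  · obtain ⟨s, rfl⟩ := N.exists_base h
    simp [(N.base_injective i).eq_iff]
  · refine Finset.sum_eq_zero fun s _ => if_neg ?_
    rintro rfl
    exact h (N.coord_base_self i s)

lemma lineMatrix_mulVec_delta (j : Fin 3) : N.lineMatrix j *ᵥ N.delta = N.lineVec j := by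
  ext x
  simp [lineMatrix, delta, lineVec]

lemma lineMatrix_mulVec_one (j : Fin 3) : N.lineMatrix j *ᵥ 1 = 1 := by
  ext x
  simp [lineMatrix, mulVec, dotProduct]

lemma pointVec_dotProduct_pointVec : N.pointVec ⬝ᵥ N.pointVec = 1 := by
  simp [pointVec]

lemma pointVec_dotProduct_lineVec (i : Fin 3) : N.pointVec ⬝ᵥ N.lineVec i = 1 := by
  simp [pointVec, lineVec, N.coord_base_e]

lemma pointVec_dotProduct_one : N.pointVec ⬝ᵥ (1 : X → ℂ) = 1 := by
  simp [pointVec]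

lemma lineVec_dotProduct_one (i : Fin 3) :
    N.lineVec i ⬝ᵥ (1 : X → ℂ) = Fintype.card S := by
  have := N.sum_coord_one i fun s => if s = N.e then 1 else 0
  simpa [dotProduct, lineVec] using this

lemma lineVec_dotProduct_lineVec (i j : Fin 3) :
    N.lineVec i ⬝ᵥ N.lineVec j = if i = j then (Fintype.card S : ℂ) else 1 := by
  split_ifs with h
  · subst h
    rw [← N.lineVec_dotProduct_one i]
    simp only [dotProduct, lineVec, ite_mul, one_mul, zero_mul, Pi.one_apply, mul_one]
    exact Finset.sum_congr rfl fun x _ => by split_ifs <;> rfl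
  · have := N.sum_coord h fun s t => (if s = N.e then 1 else 0) * (if t = N.e then 1 else 0)
    rw [dotProduct]
    refine this.trans ?_
    simp

lemma one_dotProduct_one_points (N : LoopNet X S) :
    (1 : X → ℂ) ⬝ᵥ 1 = (Fintype.card S : ℂ) ^ 2 := by
  simp [N.card_points]

/-- The classes partition the points, so their Gram matrix is diagonal with the class sizes as
entries. -/
lemma classVec_dotProduct (i j : Fin 5) :
    N.classVec i ⬝ᵥ N.classVec j = diagonal (classSize (Fintype.card S)) i j := by
  have h1 := fun i => (dotProduct_comm _ _).trans (N.pointVec_dotProduct_lineVec i)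
  have h2 := (dotProduct_comm _ _).trans N.pointVec_dotProduct_one
  have h3 := fun i => (dotProduct_comm _ _).trans (N.lineVec_dotProduct_one i)
  fin_cases i <;> fin_cases j <;>
    simp [classVec, classSize, dotProduct_add, dotProduct_sub, sub_dotProduct, add_dotProduct,
      smul_dotProduct, dotProduct_smul, h1, h2, h3, N.pointVec_dotProduct_pointVec,
      N.pointVec_dotProduct_lineVec, N.pointVec_dotProduct_one, N.lineVec_dotProduct_one,
      N.lineVec_dotProduct_lineVec,
      N.one_dotProduct_one_points] <;> ring

lemma isUnit_det_diagonal_classSize {n : ℕ} (hn : 5 ≤ n) :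
    IsUnit (diagonal (classSize (n : ℂ))).det := by
  obtain ⟨k, rfl⟩ := Nat.exists_eq_add_of_le hn
  have h1 : ((5 + k : ℕ) : ℂ) - 1 ≠ 0 := by
    rw [sub_ne_zero]; exact_mod_cast (by omega : 5 + k ≠ 1)
  have h2 : ((5 + k : ℕ) : ℂ) - 2 ≠ 0 := by
    rw [sub_ne_zero]; exact_mod_cast (by omega : 5 + k ≠ 2)
  rw [det_diagonal, isUnit_iff_ne_zero, Finset.prod_ne_zero_iff]
  intro i _
  fin_cases i <;> simp only [classSize] <;> first | exact h1 | exact mul_ne_zero h1 h2 | simp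

/-- The units of the primary block. -/
def primaryUnit (i j : Fin 5) : Matrix X X ℂ := vecMulVec (N.classVec i) (N.classVec j)

/-- The units of the block attached to a projection `P`. -/
def blockUnit (P : Matrix S S ℂ) (a b : Fin 3 ⊕ Fin 3) : Matrix X X ℂ :=
  N.inc a * P * (N.inc b)ᵀ

lemma primaryUnit_mul (a b c d : Fin 5) : N.primaryUnit a b * N.primaryUnit c d =
    diagonal (classSize (Fintype.card S)) b c • N.primaryUnit a d := by
  rw [primaryUnit, primaryUnit, vecMulVec_mul_vecMulVec, classVec_dotProduct]
  simp [primaryUnit, vecMulVec_smul]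

lemma trace_primaryUnit (a b : Fin 5) :
    (N.primaryUnit a b).trace = diagonal (classSize (Fintype.card S)) b a * 1 := by
  rw [primaryUnit, trace_vecMulVec, dotProduct_comm, classVec_dotProduct, mul_one]

variable {N}

/-- The inner product of incidence matrices acts on `P'` as a scalar. Keeping two projections serves
both `P = P'`, for multiplication in a block, and `P * P' = 0`, for orthogonality of blocks. -/
lemma IsEigen.blockUnit_mul {lam : ℂ} {P P' : Matrix S S ℂ} (hP : N.IsEigen lam P')
    (a b c d : Fin 3 ⊕ Fin 3) : N.blockUnit P a b * N.blockUnit P' c d =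
      gram (Fintype.card S) lam b c • N.blockUnit (P * P') a d := by
  have : N.blockUnit P a b * N.blockUnit P' c d
      = N.inc a * P * ((N.inc b)ᵀ * N.inc c * P') * (N.inc d)ᵀ := by
    simp only [blockUnit, Matrix.mul_assoc]
  rw [this, hP.inc_mul, blockUnit, Matrix.mul_smul, Matrix.smul_mul, Matrix.mul_assoc (N.inc a)]

lemma IsEigen.trace_blockUnit {lam : ℂ} {P : Matrix S S ℂ} (hP : N.IsEigen lam P)
    (a b : Fin 3 ⊕ Fin 3) :
    (N.blockUnit P a b).trace = gram (Fintype.card S) lam b a * P.trace := by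
  rw [blockUnit, trace_mul_comm, ← Matrix.mul_assoc, hP.inc_mul, trace_smul, smul_eq_mul]

lemma IsEigen.inc_mulVec_vecMul {lam : ℂ} {P : Matrix S S ℂ} (hP : N.IsEigen lam P)
    (a b : Fin 3 ⊕ Fin 3) {w : S → ℂ} (hw : w ᵥ* P = 0) :
    (N.inc a *ᵥ w) ᵥ* (N.inc b * P) = 0 := by
  rw [← vecMul_transpose, vecMul_vecMul, ← Matrix.mul_assoc, hP.inc_mul, vecMul_smul, hw,
    smul_zero]

/-- Class vectors are combinations of images of `delta` and the constant vector under incidence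
matrices, and `P` annihilates both of these. -/
lemma IsEigen.classVec_vecMul {lam : ℂ} {P : Matrix S S ℂ} (hP : N.IsEigen lam P) (i : Fin 5)
    (b : Fin 3 ⊕ Fin 3) : N.classVec i ᵥ* (N.inc b * P) = 0 := by
  have h1 : N.pointVec ᵥ* (N.inc b * P) = 0 := by
    rw [← N.baseMatrix_mulVec_delta 0]
    exact hP.inc_mulVec_vecMul (.inl 0) b hP.delta_vecMul
  have h2 : ∀ i, N.lineVec i ᵥ* (N.inc b * P) = 0 := fun i => by
    rw [← N.baseMatrix_mulVec_one i]
    exact hP.inc_mulVec_vecMul (.inl i) b hP.one_vecMul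
  have h3 : 1 ᵥ* (N.inc b * P) = 0 := by
    rw [← N.lineMatrix_mulVec_one 0]
    exact hP.inc_mulVec_vecMul (.inr 0) b hP.one_vecMul
  fin_cases i <;> simp [classVec, sub_vecMul, add_vecMul, smul_vecMul, h1, h2, h3]

lemma IsEigen.primaryUnit_mul_blockUnit {lam : ℂ} {P : Matrix S S ℂ} (hP : N.IsEigen lam P)
    (i j : Fin 5) (a b : Fin 3 ⊕ Fin 3) : N.primaryUnit i j * N.blockUnit P a b = 0 := by
  rw [primaryUnit, blockUnit, vecMulVec_mul, ← vecMul_vecMul, hP.classVec_vecMul]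
  simp

lemma IsEigen.blockUnit_mul_primaryUnit {lam : ℂ} {P : Matrix S S ℂ} (hP : N.IsEigen lam P)
    (hPt : Pᵀ = P) (i j : Fin 5) (a b : Fin 3 ⊕ Fin 3) :
    N.blockUnit P a b * N.primaryUnit i j = 0 := by
  rw [← transpose_inj, transpose_mul]
  have h1 : (N.blockUnit P a b)ᵀ = N.blockUnit P b a := by
    simp [blockUnit, hPt, Matrix.mul_assoc]
  rw [h1, primaryUnit, transpose_vecMulVec]
  exact hP.primaryUnit_mul_blockUnit j i b a

variable (N) in
lemma blockUnit_ne_zero {P : Matrix S S ℂ} (h0 : P ≠ 0) :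
    N.blockUnit P (.inl 0) (.inl 0) ≠ 0 := by
  have hb : (N.inc (.inl 0))ᵀ * N.inc (.inl 0) = 1 := N.baseMatrix_transpose_mul_self 0
  intro h
  apply h0
  have h2 : (N.inc (.inl 0))ᵀ * N.blockUnit P (.inl 0) (.inl 0) * N.inc (.inl 0)
      = ((N.inc (.inl 0))ᵀ * N.inc (.inl 0)) * P * ((N.inc (.inl 0))ᵀ * N.inc (.inl 0)) := by
    simp only [blockUnit, Matrix.mul_assoc]
  rw [h, hb] at h2
  simpa using h2.symm

variable (N)

lemma evenProj_mul_self (hn : 5 ≤ Fintype.card S) : N.evenProj * N.evenProj = N.evenProj := by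
  rw [(N.isEigen_evenProj hn).evenProj_mul]; norm_num

lemma oddProj_mul_self : N.oddProj * N.oddProj = N.oddProj := by
  rw [N.isEigen_oddProj.oddProj_mul]; norm_num

lemma evenProj_mul_oddProj : N.evenProj * N.oddProj = 0 := by
  rw [N.isEigen_oddProj.evenProj_mul]; norm_num

lemma oddProj_mul_evenProj (hn : 5 ≤ Fintype.card S) : N.oddProj * N.evenProj = 0 := by
  rw [(N.isEigen_evenProj hn).oddProj_mul]; norm_num

lemma dotProduct_codelta : N.codelta ⬝ᵥ N.codelta = Fintype.card S - 1 := by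
  rw [← N.sum_codelta, dotProduct]
  refine Finset.sum_congr rfl fun s _ => ?_
  by_cases h : s = N.e <;> simp [codelta, delta, h]

lemma trace_evenProj (hn : 5 ≤ Fintype.card S) :
    N.evenProj.trace = (Fintype.card S + N.invMatrix.trace) / 2 - 2 := by
  have hn' : (Fintype.card S : ℂ) - 1 ≠ 0 := by
    rw [sub_ne_zero]; exact_mod_cast (by omega : Fintype.card S ≠ 1)
  have hd : N.delta ⬝ᵥ N.delta = 1 := by simp [delta]
  simp only [evenProj, trace_sub, trace_smul, trace_add, trace_one, trace_vecMulVec, hd,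
    dotProduct_codelta, smul_eq_mul]
  rw [one_div_mul_cancel hn']
  ring

lemma trace_oddProj :
    N.oddProj.trace = (Fintype.card S - N.invMatrix.trace) / 2 := by
  simp only [oddProj, trace_sub, trace_smul, trace_one, smul_eq_mul]
  ring

/-- Its trace is `(n + f) / 2 - 2` with `f` the number of fixed points of `inv`; vanishing would
force `n + f = 4`. -/
lemma evenProj_ne_zero (hn : 5 ≤ Fintype.card S) : N.evenProj ≠ 0 := by
  intro h
  have h1 := N.trace_evenProj hn
  have h2 : N.invMatrix.trace = ((Finset.univ.filter fun s => N.inv s = s).card : ℂ) := by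
    simp [trace, invMatrix]
  rw [h, h2, trace_zero] at h1
  have h3 : ((Fintype.card S + (Finset.univ.filter fun s => N.inv s = s).card : ℕ) : ℂ)
      = (4 : ℕ) := by
    push_cast
    linear_combination (-2) * h1
  have := Nat.cast_injective h3
  omega

end LoopNet

/-! ### The algebra generated by the incidence matrices contains, and is generated by, the blocks -/

namespace LoopNet

open Matrix

variable {X S : Type*} (N : LoopNet X S) [DecidableEq X] [DecidableEq S] [Fintype X] [Fintype S]

/-- The algebra generated by the matrices `F * Fᵀ`, with `F` an incidence matrix. -/
noncomputable def incAlgebra : Subalgebra ℂ (Matrix X X ℂ) :=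
  Algebra.adjoin ℂ (Set.range fun a => N.inc a * (N.inc a)ᵀ)

lemma inc_mul_transpose_mem (a : Fin 3 ⊕ Fin 3) : N.inc a * (N.inc a)ᵀ ∈ N.incAlgebra :=
  Algebra.subset_adjoin ⟨a, rfl⟩

lemma transpose_mem {M : Matrix X X ℂ} (h : M ∈ N.incAlgebra) : Mᵀ ∈ N.incAlgebra := by
  induction h using Algebra.adjoin_induction with
  | mem x hx =>
    obtain ⟨a, rfl⟩ := hx
    simpa using N.inc_mul_transpose_mem a
  | algebraMap r =>
    rw [Matrix.algebraMap_eq_diagonal, diagonal_transpose, ← Matrix.algebraMap_eq_diagonal]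
    exact Subalgebra.algebraMap_mem _ r
  | add x y _ _ hx hy => rw [transpose_add]; exact add_mem hx hy
  | mul x y _ _ hx hy => rw [transpose_mul]; exact mul_mem hy hx

lemma baseMatrix_transpose_mul_lineMatrix (i j : Fin 3) :
    (N.baseMatrix i)ᵀ * N.lineMatrix j =
      of fun s t => if N.coord j (N.base i s) = t then 1 else 0 := by
  rw [baseMatrix_transpose_mul]; rfl

/-- These elements move everything to the line `base 0`. They arise because the generators contain
inner factors `(baseMatrix i)ᵀ * lineMatrix j`, which equal `1` for all `i ≠ j` except `(2, 1)`,
where the inversion appears. -/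
lemma inc_mul_baseMatrix_transpose_mem (a : Fin 3 ⊕ Fin 3) :
    N.inc a * (N.baseMatrix 0)ᵀ ∈ N.incAlgebra := by
  have hH : ∀ i, N.baseMatrix i * (N.baseMatrix i)ᵀ ∈ N.incAlgebra := fun i =>
    N.inc_mul_transpose_mem (.inl i)
  have hD : ∀ j, N.lineMatrix j * (N.lineMatrix j)ᵀ ∈ N.incAlgebra := fun j =>
    N.inc_mul_transpose_mem (.inr j)
  have hone : (of fun s t : S => if s = t then (1 : ℂ) else 0) = 1 := by
    ext s t; simp [Matrix.one_apply]
  have h01 : (N.baseMatrix 0)ᵀ * N.lineMatrix 1 = 1 := by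
    simp [baseMatrix_transpose_mul_lineMatrix, N.coord_base, hone]
  have h02 : (N.baseMatrix 0)ᵀ * N.lineMatrix 2 = 1 := by
    simp [baseMatrix_transpose_mul_lineMatrix, N.coord_base, hone]
  have h10 : (N.baseMatrix 1)ᵀ * N.lineMatrix 0 = 1 := by
    simp [baseMatrix_transpose_mul_lineMatrix, N.coord_base, hone]
  have h12 : (N.baseMatrix 1)ᵀ * N.lineMatrix 2 = 1 := by
    simp [baseMatrix_transpose_mul_lineMatrix, N.coord_base, hone]
  have h20 : (N.baseMatrix 2)ᵀ * N.lineMatrix 0 = 1 := by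
    simp [baseMatrix_transpose_mul_lineMatrix, N.coord_base, hone]
  have flip : ∀ {i j}, (N.baseMatrix i)ᵀ * N.lineMatrix j = 1 →
      (N.lineMatrix j)ᵀ * N.baseMatrix i = 1 := fun h => by
    simpa using congrArg transpose h
  have line : ∀ {i j}, (N.baseMatrix i)ᵀ * N.lineMatrix j = 1 →
      N.lineMatrix j * (N.baseMatrix i)ᵀ ∈ N.incAlgebra := fun {i j} h => by
    have h' := mul_mem (hD j) (hH i)
    rwa [Matrix.mul_assoc, ← Matrix.mul_assoc _ (N.baseMatrix i), flip h, Matrix.one_mul] at h'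
  have base : ∀ {i j k}, (N.baseMatrix i)ᵀ * N.lineMatrix j = 1 →
      (N.baseMatrix k)ᵀ * N.lineMatrix j = 1 →
      N.baseMatrix i * (N.baseMatrix k)ᵀ ∈ N.incAlgebra := fun {i j k} h h1 => by
    have h' := mul_mem (hH i) (line h1)
    rwa [Matrix.mul_assoc, ← Matrix.mul_assoc _ (N.lineMatrix j), h, Matrix.one_mul] at h'
  have trans : ∀ {M : Matrix X S ℂ} {i k}, M * (N.baseMatrix i)ᵀ ∈ N.incAlgebra →
      N.baseMatrix i * (N.baseMatrix k)ᵀ ∈ N.incAlgebra → M * (N.baseMatrix k)ᵀ ∈ N.incAlgebra :=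
    fun {M i k} h h1 => by
      have h' := mul_mem h h1
      rwa [Matrix.mul_assoc, ← Matrix.mul_assoc _ (N.baseMatrix i),
        baseMatrix_transpose_mul_self, Matrix.one_mul] at h'
  have b10 := base h12 h02
  have b20 := trans (base h20 h10) b10
  rcases a with i | j
  · fin_cases i
    · exact hH 0
    · exact b10
    · exact b20
  · fin_cases j
    · exact trans (line h10) b10
    · exact line h01
    · exact line h02

/-- Since `(baseMatrix 0)ᵀ * baseMatrix 0 = 1`, such factors can be inserted on both sides of `P`,
so only the block on one line needs checking. -/
lemma blockUnit_mem_of_base {P : Matrix S S ℂ}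
    (h : N.baseMatrix 0 * P * (N.baseMatrix 0)ᵀ ∈ N.incAlgebra) (a b : Fin 3 ⊕ Fin 3) :
    N.blockUnit P a b ∈ N.incAlgebra := by
  have h1 := N.inc_mul_baseMatrix_transpose_mem a
  have h2 := N.transpose_mem (N.inc_mul_baseMatrix_transpose_mem b)
  have h3 := mul_mem (mul_mem h1 h) h2
  convert h3 using 1
  have h4 := N.baseMatrix_transpose_mul_self 0
  calc N.blockUnit P a b
      = N.inc a * ((N.baseMatrix 0)ᵀ * N.baseMatrix 0) * P *
          ((N.baseMatrix 0)ᵀ * N.baseMatrix 0) * (N.inc b)ᵀ := by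
        rw [h4]; simp [blockUnit]
    _ = _ := by simp only [Matrix.mul_assoc, transpose_mul, transpose_transpose]

lemma baseMatrix_mul_vecMulVec (v w : S → ℂ) (i : Fin 3) :
    N.baseMatrix i * vecMulVec v w * (N.baseMatrix i)ᵀ =
      vecMulVec (N.baseMatrix i *ᵥ v) (N.baseMatrix i *ᵥ w) := by
  rw [mul_vecMulVec, vecMulVec_mul, vecMul_transpose]

/-- A line of one class meets a line of another in exactly one point, so every entry is `1`. -/
lemma lineMatrix_mul_transpose_mul {i j : Fin 3} (hij : i ≠ j) :
    N.lineMatrix i * (N.lineMatrix i)ᵀ * (N.lineMatrix j * (N.lineMatrix j)ᵀ) =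
      vecMulVec 1 1 := by
  ext x y
  have h := (N.sum_coord hij fun s t =>
    (if s = N.coord i x then 1 else 0) * (if N.coord j y = t then 1 else 0)).trans
    (by simp : _ = (1 : ℂ))
  rw [Matrix.mul_apply]
  have hxy : vecMulVec (1 : X → ℂ) (1 : X → ℂ) x y = 1 := by simp [vecMulVec_apply]
  rw [hxy, ← h]
  rw [lineMatrix_mul, lineMatrix_mul]
  rfl

lemma baseMatrix_mul_transpose (i : Fin 3) :
    N.baseMatrix i * (N.baseMatrix i)ᵀ = diagonal (N.lineVec i) := by
  ext x y
  simp only [baseMatrix, Matrix.mul_apply, of_apply, transpose_apply, diagonal_apply, lineVec,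
    mul_ite, mul_one, mul_zero]
  by_cases h : N.coord i x = N.e
  · obtain ⟨s, rfl⟩ := N.exists_base h
    rw [Finset.sum_eq_single s (fun t _ ht => by simp [(N.base_injective i).eq_iff, ht.symm])
      (by simp)]
    simp [N.coord_base_self, eq_comm]
  · have : ∀ s, x ≠ N.base i s := fun s hs => h (by rw [hs, N.coord_base_self])
    simp [this, h]

lemma lineVec_mul_lineVec {i j : Fin 3} (hij : i ≠ j) :
    N.lineVec i * N.lineVec j = N.pointVec := by
  ext x
  by_cases hx : x = N.base 0 N.e
  · subst hx
    simp [lineVec, pointVec, N.coord_base_e]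
  · simp only [lineVec, pointVec, Pi.mul_apply, Pi.single_eq_of_ne hx]
    by_cases hi : N.coord i x = N.e
    · have hj : N.coord j x ≠ N.e := fun hj => hx (N.eq_base_e hij hi hj)
      simp [hj]
    · simp [hi]

lemma diagonal_pointVec : diagonal N.pointVec =
    N.baseMatrix 0 * (N.baseMatrix 0)ᵀ * (N.baseMatrix 1 * (N.baseMatrix 1)ᵀ) := by
  rw [baseMatrix_mul_transpose, baseMatrix_mul_transpose, diagonal_mul_diagonal,
    ← N.lineVec_mul_lineVec (i := 0) (j := 1) (by decide)]
  rfl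

lemma diagonal_classVec_mem (i : Fin 5) : diagonal (N.classVec i) ∈ N.incAlgebra := by
  have hH : ∀ i, diagonal (N.lineVec i) ∈ N.incAlgebra := fun i => by
    rw [← baseMatrix_mul_transpose]
    exact N.inc_mul_transpose_mem (.inl i)
  have hE : diagonal N.pointVec ∈ N.incAlgebra := by
    rw [diagonal_pointVec]
    exact mul_mem (N.inc_mul_transpose_mem (.inl 0)) (N.inc_mul_transpose_mem (.inl 1))
  have h1 : (1 : Matrix X X ℂ) ∈ N.incAlgebra := one_mem _
  have hd : ∀ i, diagonal (N.lineVec i - N.pointVec) ∈ N.incAlgebra := fun i => by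
    have := sub_mem (hH i) hE
    rwa [diagonal_sub] at this
  fin_cases i
  · exact hE
  · exact hd 0
  · exact hd 1
  · exact hd 2
  · have := add_mem (sub_mem (sub_mem (sub_mem h1 (hH 0)) (hH 1)) (hH 2))
      (Subalgebra.smul_mem _ hE 2)
    convert this using 1
    rw [← diagonal_one, ← diagonal_smul, diagonal_sub, diagonal_sub, diagonal_sub, diagonal_add]
    rfl

lemma vecMulVec_one_mem : (vecMulVec 1 1 : Matrix X X ℂ) ∈ N.incAlgebra := by
  rw [← N.lineMatrix_mul_transpose_mul (i := 0) (j := 1) (by decide)]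
  exact mul_mem (N.inc_mul_transpose_mem (.inr 0)) (N.inc_mul_transpose_mem (.inr 1))

lemma primaryUnit_mem (i j : Fin 5) : N.primaryUnit i j ∈ N.incAlgebra := by
  have := mul_mem (mul_mem (N.diagonal_classVec_mem i) N.vecMulVec_one_mem) (N.diagonal_classVec_mem j)
  convert this using 1
  ext x y
  simp [primaryUnit, vecMulVec_apply, Matrix.diagonal_mul, Matrix.mul_diagonal]

/-- The path from line `0` through the parallel class `1` to line `2` and back to line `0` realizes
the inversion inside the algebra. -/
lemma baseMatrix_mul_invMatrix_mem :
    N.baseMatrix 0 * N.invMatrix * (N.baseMatrix 0)ᵀ ∈ N.incAlgebra := by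
  have h01 : (N.baseMatrix 0)ᵀ * N.lineMatrix 1 = 1 := by
    rw [baseMatrix_transpose_mul_lineMatrix]
    ext s t
    simp [N.coord_base, Matrix.one_apply]
  have h21 : (N.lineMatrix 1)ᵀ * N.baseMatrix 2 = N.invMatrix := by
    rw [← N.invMatrix_transpose, ← transpose_inj, transpose_mul, transpose_transpose,
      transpose_transpose, baseMatrix_transpose_mul_lineMatrix]
    ext s t
    simp [N.coord_base, invMatrix]
  have h := mul_mem (mul_mem (N.inc_mul_transpose_mem (.inl 0)) (N.inc_mul_transpose_mem (.inr 1)))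
    (N.inc_mul_baseMatrix_transpose_mem (.inl 2))
  convert h using 1
  calc _ = N.baseMatrix 0 * ((N.baseMatrix 0)ᵀ * N.lineMatrix 1) *
        ((N.lineMatrix 1)ᵀ * N.baseMatrix 2) * (N.baseMatrix 0)ᵀ := by
        rw [h01, h21, Matrix.mul_one]
    _ = _ := by simp only [inc, Sum.elim_inl, Sum.elim_inr, Matrix.mul_assoc]

lemma baseMatrix_mulVec_codelta : N.baseMatrix 0 *ᵥ N.codelta = N.classVec 1 := by
  rw [codelta, mulVec_sub, baseMatrix_mulVec_one, baseMatrix_mulVec_delta]; rfl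

lemma blockUnit_oddProj_mem (a b : Fin 3 ⊕ Fin 3) : N.blockUnit N.oddProj a b ∈ N.incAlgebra := by
  apply N.blockUnit_mem_of_base
  rw [oddProj, Matrix.mul_smul, Matrix.smul_mul, Matrix.mul_sub, Matrix.sub_mul, Matrix.mul_one]
  exact Subalgebra.smul_mem _ (sub_mem (N.inc_mul_transpose_mem (.inl 0))
    N.baseMatrix_mul_invMatrix_mem) _

lemma blockUnit_evenProj_mem (a b : Fin 3 ⊕ Fin 3) :
    N.blockUnit N.evenProj a b ∈ N.incAlgebra := by
  apply N.blockUnit_mem_of_base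
  simp only [evenProj, Matrix.mul_smul, Matrix.smul_mul, Matrix.mul_sub, Matrix.sub_mul,
    Matrix.mul_one, Matrix.mul_add, Matrix.add_mul, baseMatrix_mul_vecMulVec,
    baseMatrix_mulVec_codelta, baseMatrix_mulVec_delta]
  exact sub_mem (sub_mem (Subalgebra.smul_mem _ (add_mem (N.inc_mul_transpose_mem (.inl 0))
    N.baseMatrix_mul_invMatrix_mem) _) (N.primaryUnit_mem 0 0))
    (Subalgebra.smul_mem _ (N.primaryUnit_mem 1 1) _)

lemma vecMulVec_mem_of_primaryUnit_mem {𝓡 : Subalgebra ℂ (Matrix X X ℂ)}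
    (h : ∀ i j, N.primaryUnit i j ∈ 𝓡) {v w : X → ℂ}
    (hv : v ∈ Submodule.span ℂ (Set.range N.classVec))
    (hw : w ∈ Submodule.span ℂ (Set.range N.classVec)) : vecMulVec v w ∈ 𝓡 := by
  induction hv, hw using Submodule.span_induction₂ with
  | mem_mem x y hx hy =>
    obtain ⟨i, rfl⟩ := hx
    obtain ⟨j, rfl⟩ := hy
    exact h i j
  | zero_left y _ => simp
  | zero_right x _ => simp
  | add_left x y z _ _ _ h1 h2 => rw [add_vecMulVec]; exact add_mem h1 h2
  | add_right x y z _ _ _ h1 h2 => rw [vecMulVec_add]; exact add_mem h1 h2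
  | smul_left r x y _ _ h1 => rw [smul_vecMulVec]; exact Subalgebra.smul_mem _ h1 r
  | smul_right r x y _ _ h1 => rw [vecMulVec_smul]; exact Subalgebra.smul_mem _ h1 r

lemma pointVec_mem_span : N.pointVec ∈ Submodule.span ℂ (Set.range N.classVec) :=
  Submodule.subset_span ⟨0, rfl⟩

lemma lineVec_mem_span (i : Fin 3) : N.lineVec i ∈ Submodule.span ℂ (Set.range N.classVec) := by
  have h : N.lineVec i - N.pointVec ∈ Submodule.span ℂ (Set.range N.classVec) := by
    fin_cases i
    · exact Submodule.subset_span ⟨1, rfl⟩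
    · exact Submodule.subset_span ⟨2, rfl⟩
    · exact Submodule.subset_span ⟨3, rfl⟩
  simpa using add_mem h N.pointVec_mem_span

lemma one_mem_span : (1 : X → ℂ) ∈ Submodule.span ℂ (Set.range N.classVec) := by
  have h : N.classVec 4 ∈ Submodule.span ℂ (Set.range N.classVec) :=
    Submodule.subset_span ⟨4, rfl⟩
  have h2 := sub_mem (add_mem (add_mem (add_mem h (N.lineVec_mem_span 0)) (N.lineVec_mem_span 1))
    (N.lineVec_mem_span 2)) (Submodule.smul_mem _ (2 : ℂ) N.pointVec_mem_span)
  convert h2 using 1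
  simp only [classVec, cons_val]
  abel

lemma inc_mulVec_delta_mem_span (a : Fin 3 ⊕ Fin 3) :
    N.inc a *ᵥ N.delta ∈ Submodule.span ℂ (Set.range N.classVec) := by
  rcases a with i | j
  · simpa [inc, baseMatrix_mulVec_delta] using N.pointVec_mem_span
  · simpa [inc, lineMatrix_mulVec_delta] using N.lineVec_mem_span j

lemma inc_mulVec_codelta_mem_span (a : Fin 3 ⊕ Fin 3) :
    N.inc a *ᵥ N.codelta ∈ Submodule.span ℂ (Set.range N.classVec) := by
  rw [codelta, mulVec_sub]
  refine sub_mem ?_ (N.inc_mulVec_delta_mem_span a)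
  rcases a with i | j
  · simpa only [inc, Sum.elim_inl, baseMatrix_mulVec_one] using N.lineVec_mem_span i
  · simpa only [inc, Sum.elim_inr, lineMatrix_mulVec_one] using N.one_mem_span

/-- Insert into `F * Fᵀ` the resolution of the identity on symbol vectors into the even, odd,
`delta` and `codelta` projections. The last two give products of vectors in the span of the classes.
-/
lemma incAlgebra_le {𝓡 : Subalgebra ℂ (Matrix X X ℂ)} (h5 : ∀ i j, N.primaryUnit i j ∈ 𝓡)
    (hev : ∀ a b, N.blockUnit N.evenProj a b ∈ 𝓡) (hod : ∀ a b, N.blockUnit N.oddProj a b ∈ 𝓡) :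
    N.incAlgebra ≤ 𝓡 := by
  refine Algebra.adjoin_le ?_
  rintro _ ⟨a, rfl⟩
  have h1 : (1 : Matrix S S ℂ) = N.evenProj + N.oddProj + vecMulVec N.delta N.delta
      + (1 / ((Fintype.card S : ℂ) - 1)) • vecMulVec N.codelta N.codelta := by
    rw [evenProj, oddProj]; module
  have h2 : N.inc a * (N.inc a)ᵀ = N.blockUnit N.evenProj a a + N.blockUnit N.oddProj a a
      + vecMulVec (N.inc a *ᵥ N.delta) (N.inc a *ᵥ N.delta)
      + (1 / ((Fintype.card S : ℂ) - 1)) •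
        vecMulVec (N.inc a *ᵥ N.codelta) (N.inc a *ᵥ N.codelta) := by
    have h3 : N.inc a * (N.inc a)ᵀ = N.inc a * (1 : Matrix S S ℂ) * (N.inc a)ᵀ := by rw [Matrix.mul_one]
    rw [h3, h1]
    simp only [Matrix.mul_add, Matrix.add_mul, Matrix.mul_smul, Matrix.smul_mul, mul_vecMulVec,
      vecMulVec_mul, vecMul_transpose, blockUnit]
  show N.inc a * (N.inc a)ᵀ ∈ 𝓡
  rw [h2]
  exact add_mem (add_mem (add_mem (hev a a) (hod a a))
    (N.vecMulVec_mem_of_primaryUnit_mem h5 (N.inc_mulVec_delta_mem_span a)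
      (N.inc_mulVec_delta_mem_span a)))
    (Subalgebra.smul_mem _ (N.vecMulVec_mem_of_primaryUnit_mem h5
      (N.inc_mulVec_codelta_mem_span a) (N.inc_mulVec_codelta_mem_span a)) _)

end LoopNet

/-! ### Decomposition of the algebra into blocks -/

/-- Used to find the rank of the identity of each block: the trace reduces to that of `G⁻¹ * G`. -/
lemma trace_gramHom_one {X α : Type*} [Fintype X] [DecidableEq X] [Fintype α] [DecidableEq α]
    {G : Matrix α α ℂ} (hG : IsUnit G.det) {u : α → α → Matrix X X ℂ} {t : ℂ}
    (h : ∀ a b, (u a b).trace = G b a * t) :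
    (gramHom G u 1).trace = Fintype.card α * t := by
  have h1 : (G⁻¹ * G).trace = (Fintype.card α : ℂ) := by
    rw [Matrix.nonsing_inv_mul _ hG, Matrix.trace_one]
  rw [gramHom_apply, one_mul, unitsLift_apply, ← h1]
  simp only [Matrix.trace_sum, Matrix.trace_smul, h, smul_eq_mul]
  simp only [Matrix.trace, Matrix.diag_apply, Matrix.mul_apply, Finset.sum_mul, mul_assoc]

namespace LoopNet

open Matrix

variable {X S : Type*} (N : LoopNet X S) [DecidableEq X] [DecidableEq S] [Fintype X] [Fintype S]

/-- The primary block. -/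
noncomputable def primaryHom : Matrix (Fin 5) (Fin 5) ℂ →ₗ[ℂ] Matrix X X ℂ :=
  gramHom (diagonal (classSize (Fintype.card S))) N.primaryUnit

/-- Matrices indexed by the six incidence matrices, as `6 × 6` matrices. -/
noncomputable def sixEquiv : Matrix (Fin 6) (Fin 6) ℂ ≃ₐ[ℂ]
    Matrix (Fin 3 ⊕ Fin 3) (Fin 3 ⊕ Fin 3) ℂ :=
  (reindexAlgEquiv ℂ ℂ (finSumFinEquiv (m := 3) (n := 3))).symm

/-- The block attached to a projection `P`. -/
noncomputable def blockHom (lam : ℂ) (P : Matrix S S ℂ) :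
    Matrix (Fin 6) (Fin 6) ℂ →ₗ[ℂ] Matrix X X ℂ :=
  gramHom (gram (Fintype.card S) lam) (N.blockUnit P) ∘ₗ
    sixEquiv.toLinearMap

lemma blockHom_apply (lam : ℂ) (P : Matrix S S ℂ) (M : Matrix (Fin 6) (Fin 6) ℂ) :
    N.blockHom lam P M = gramHom (gram (Fintype.card S) lam) (N.blockUnit P) (sixEquiv M) := rfl

lemma blockHom_one (lam : ℂ) (P : Matrix S S ℂ) :
    N.blockHom lam P 1 = gramHom (gram (Fintype.card S) lam) (N.blockUnit P) 1 := by
  rw [blockHom_apply, map_one]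

lemma primaryHom_mul (hn : 5 ≤ Fintype.card S) (x y : Matrix (Fin 5) (Fin 5) ℂ) :
    N.primaryHom (x * y) = N.primaryHom x * N.primaryHom y :=
  gramHom_mul (isUnit_det_diagonal_classSize hn) N.primaryUnit_mul x y

lemma primaryHom_injective (hn : 5 ≤ Fintype.card S) : Function.Injective N.primaryHom := by
  refine gramHom_injective (isUnit_det_diagonal_classSize hn) N.primaryUnit_mul
    (a₀ := 0) (b₀ := 0) fun h => ?_
  have := N.trace_primaryUnit 0 0
  simp [h, classSize] at this

lemma blockHom_mul (hn : 5 ≤ Fintype.card S) {lam : ℂ} (hl : lam = 1 ∨ lam = -1)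
    {P : Matrix S S ℂ} (hP : N.IsEigen lam P) (hPP : P * P = P)
    (x y : Matrix (Fin 6) (Fin 6) ℂ) :
    N.blockHom lam P (x * y) = N.blockHom lam P x * N.blockHom lam P y := by
  simp only [blockHom_apply, map_mul]
  exact gramHom_mul (isUnit_det_gram hn hl) (fun a b c d => by
    rw [hP.blockUnit_mul a b c d, hPP]) _ _

lemma blockHom_injective (hn : 5 ≤ Fintype.card S) {lam : ℂ} (hl : lam = 1 ∨ lam = -1)
    {P : Matrix S S ℂ} (hP : N.IsEigen lam P) (hPP : P * P = P) (h0 : P ≠ 0) :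
    Function.Injective (N.blockHom lam P) := by
  refine (gramHom_injective (isUnit_det_gram hn hl) (fun a b c d => ?_)
    (N.blockUnit_ne_zero h0)).comp (AlgEquiv.injective _)
  rw [hP.blockUnit_mul a b c d, hPP]

lemma blockHom_mul_blockHom_eq_zero {lam mu : ℂ} {P Q : Matrix S S ℂ} (hQ : N.IsEigen mu Q)
    (hPQ : P * Q = 0) (x y : Matrix (Fin 6) (Fin 6) ℂ) :
    N.blockHom lam P x * N.blockHom mu Q y = 0 := by
  have h : ∀ a b c d, N.blockUnit P a b * N.blockUnit Q c d = 0 := fun a b c d => by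
    rw [hQ.blockUnit_mul, hPQ]
    simp [blockUnit]
  rw [blockHom_apply, blockHom_apply]
  exact gramHom_mul_eq_zero h _ _

lemma primaryHom_mul_blockHom {lam : ℂ} {P : Matrix S S ℂ} (hP : N.IsEigen lam P)
    (x : Matrix (Fin 5) (Fin 5) ℂ) (y : Matrix (Fin 6) (Fin 6) ℂ) :
    N.primaryHom x * N.blockHom lam P y = 0 :=
  gramHom_mul_eq_zero (fun a b c d => hP.primaryUnit_mul_blockUnit a b c d) x (sixEquiv y)

lemma blockHom_mul_primaryHom {lam : ℂ} {P : Matrix S S ℂ} (hP : N.IsEigen lam P)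
    (hPt : Pᵀ = P) (x : Matrix (Fin 5) (Fin 5) ℂ) (y : Matrix (Fin 6) (Fin 6) ℂ) :
    N.blockHom lam P y * N.primaryHom x = 0 :=
  gramHom_mul_eq_zero (fun a b c d => hP.blockUnit_mul_primaryUnit hPt c d a b) (sixEquiv y) x

lemma primaryHom_mem (x : Matrix (Fin 5) (Fin 5) ℂ) : N.primaryHom x ∈ N.incAlgebra :=
  gramHom_mem (T := N.incAlgebra.toSubmodule) N.primaryUnit_mem x

lemma blockHom_mem (lam : ℂ) {P : Matrix S S ℂ} (hP : ∀ a b, N.blockUnit P a b ∈ N.incAlgebra)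
    (x : Matrix (Fin 6) (Fin 6) ℂ) : N.blockHom lam P x ∈ N.incAlgebra :=
  gramHom_mem (T := N.incAlgebra.toSubmodule) hP (sixEquiv x)

lemma primaryUnit_mem_of_hom (hn : 5 ≤ Fintype.card S) {𝓡 : Subalgebra ℂ (Matrix X X ℂ)}
    (h : ∀ x, N.primaryHom x ∈ 𝓡) (i j : Fin 5) : N.primaryUnit i j ∈ 𝓡 := by
  obtain ⟨x, hx⟩ := mem_range_gramHom (u := N.primaryUnit) (isUnit_det_diagonal_classSize hn) i j
  rw [← hx]
  exact h x

lemma blockUnit_mem_of_hom (hn : 5 ≤ Fintype.card S) {lam : ℂ} (hl : lam = 1 ∨ lam = -1)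
    {P : Matrix S S ℂ} {𝓡 : Subalgebra ℂ (Matrix X X ℂ)} (h : ∀ x, N.blockHom lam P x ∈ 𝓡)
    (a b : Fin 3 ⊕ Fin 3) : N.blockUnit P a b ∈ 𝓡 := by
  obtain ⟨x, hx⟩ := mem_range_gramHom (u := N.blockUnit P) (isUnit_det_gram hn hl) a b
  rw [← hx]
  have := h (sixEquiv.symm x)
  rwa [blockHom_apply, AlgEquiv.apply_symm_apply] at this

/-- The idempotent complementary to the primary block and the two six-dimensional blocks. -/
noncomputable def restIdempotent : Matrix X X ℂ :=
  1 - N.primaryHom 1 - N.blockHom 1 N.evenProj 1 - N.blockHom (-1) N.oddProj 1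

lemma restIdempotent_ne_zero (hn : 5 ≤ Fintype.card S) : N.restIdempotent ≠ 0 := by
  intro h
  have h0 := congrArg trace h
  have h5 : (N.primaryHom 1).trace = _ :=
    trace_gramHom_one (isUnit_det_diagonal_classSize hn) N.trace_primaryUnit
  rw [restIdempotent, trace_sub, trace_sub, trace_sub, h5, blockHom_one, blockHom_one,
    trace_gramHom_one (isUnit_det_gram hn (.inl rfl)) (N.isEigen_evenProj hn).trace_blockUnit,
    trace_gramHom_one (isUnit_det_gram hn (.inr rfl)) N.isEigen_oddProj.trace_blockUnit,
    trace_evenProj _ hn, trace_oddProj, trace_one, N.card_points, trace_zero] at h0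
  simp only [Fintype.card_sum, Fintype.card_fin] at h0
  obtain ⟨k, hk⟩ := Nat.exists_eq_add_of_le hn
  rw [hk] at h0
  -- The trace is `n² - 6n + 7` at `n = k + 5`; the fixed points of the inversion cancel between the
  -- even and odd blocks.
  have h1 : ((k ^ 2 + 4 * k + 2 : ℕ) : ℂ) = 0 := by
    rw [← h0]; push_cast; ring
  have := Nat.cast_eq_zero.mp h1
  omega

/-- The algebra of a loop net has one primary block of size five, a block of size six for each
nonzero eigenspace of the inversion, and a block of size one. -/
theorem nonempty_incAlgebra_algEquiv (hn : 5 ≤ Fintype.card S) :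
    Nonempty (N.incAlgebra ≃ₐ[ℂ]
      (Matrix (Fin 5) (Fin 5) ℂ × Matrix (Fin 6) (Fin 6) ℂ × Matrix (Fin 1) (Fin 1) ℂ)) ∨
    Nonempty (N.incAlgebra ≃ₐ[ℂ]
      (Matrix (Fin 5) (Fin 5) ℂ × Matrix (Fin 6) (Fin 6) ℂ × Matrix (Fin 6) (Fin 6) ℂ ×
        Matrix (Fin 1) (Fin 1) ℂ)) := by
  have ee := N.isEigen_evenProj hn
  have eo := N.isEigen_oddProj
  have ie := N.evenProj_mul_self hn
  have io := N.oddProj_mul_self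
  have m5 := N.primaryHom_mul hn
  have me := N.blockHom_mul hn (.inl rfl) ee ie
  have mo := N.blockHom_mul hn (.inr rfl) eo io
  have o5e := N.primaryHom_mul_blockHom ee
  have oe5 := N.blockHom_mul_primaryHom ee N.evenProj_transpose
  have o5o := N.primaryHom_mul_blockHom eo
  have oo5 := N.blockHom_mul_primaryHom eo N.oddProj_transpose
  have oeo := N.blockHom_mul_blockHom_eq_zero (lam := 1) eo N.evenProj_mul_oddProj
  have ooe := N.blockHom_mul_blockHom_eq_zero (lam := -1) ee (N.oddProj_mul_evenProj hn)
  have i5 := N.primaryHom_injective hn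
  have ine := N.blockHom_injective hn (.inl rfl) ee ie (N.evenProj_ne_zero hn)
  have z5 : ∀ x, N.primaryHom x * N.restIdempotent = 0 := fun x => by
    simp [restIdempotent, Matrix.mul_sub, ← m5, o5e, o5o]
  have z5' : ∀ x, N.restIdempotent * N.primaryHom x = 0 := fun x => by
    simp [restIdempotent, Matrix.sub_mul, ← m5, oe5, oo5]
  have ze : ∀ x, N.blockHom 1 N.evenProj x * N.restIdempotent = 0 := fun x => by
    simp [restIdempotent, Matrix.mul_sub, ← me, oe5, oeo]
  have ze' : ∀ x, N.restIdempotent * N.blockHom 1 N.evenProj x = 0 := fun x => by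
    simp [restIdempotent, Matrix.sub_mul, ← me, o5e, ooe]
  have zo : ∀ x, N.blockHom (-1) N.oddProj x * N.restIdempotent = 0 := fun x => by
    simp [restIdempotent, Matrix.mul_sub, ← mo, oo5, ooe]
  have zo' : ∀ x, N.restIdempotent * N.blockHom (-1) N.oddProj x = 0 := fun x => by
    simp [restIdempotent, Matrix.sub_mul, ← mo, o5o, oeo]
  have zz : N.restIdempotent * N.restIdempotent = N.restIdempotent := by
    conv_lhs => enter [2]; rw [restIdempotent]
    simp [Matrix.mul_sub, z5', ze', zo']
  have m1 := idempotentHom_mul zz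
  have i1 := idempotentHom_injective (N.restIdempotent_ne_zero hn)
  have t5 := N.primaryHom_mem
  have te := N.blockHom_mem 1 N.blockUnit_evenProj_mem
  have tod := N.blockHom_mem (-1) N.blockUnit_oddProj_mem
  have tz : N.restIdempotent ∈ N.incAlgebra :=
    sub_mem (sub_mem (sub_mem (one_mem _) (t5 1)) (te 1)) (tod 1)
  have t1 : ∀ x, idempotentHom N.restIdempotent x ∈ N.incAlgebra := fun x =>
    Subalgebra.smul_mem _ tz _
  have o51 : ∀ x y, N.primaryHom x * idempotentHom N.restIdempotent y = 0 := fun x y => by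
    simp [idempotentHom_apply, z5]
  have o15 : ∀ x y, idempotentHom N.restIdempotent y * N.primaryHom x = 0 := fun x y => by
    simp [idempotentHom_apply, z5']
  have oe1 : ∀ x y, N.blockHom 1 N.evenProj x * idempotentHom N.restIdempotent y = 0 :=
    fun x y => by simp [idempotentHom_apply, ze]
  have o1e : ∀ x y, idempotentHom N.restIdempotent y * N.blockHom 1 N.evenProj x = 0 :=
    fun x y => by simp [idempotentHom_apply, ze']
  have oo1 : ∀ x y, N.blockHom (-1) N.oddProj x * idempotentHom N.restIdempotent y = 0 :=
    fun x y => by simp [idempotentHom_apply, zo]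
  have o1o : ∀ x y, idempotentHom N.restIdempotent y * N.blockHom (-1) N.oddProj x = 0 :=
    fun x y => by simp [idempotentHom_apply, zo']
  -- The odd projection vanishes exactly when the inversion is the identity; its block is then
  -- absent.
  by_cases h0 : N.oddProj = 0
  · left
    have hz : N.blockHom (-1) N.oddProj 1 = 0 := by
      rw [blockHom_apply, gramHom_apply, unitsLift_apply, h0]
      simp [blockUnit]
    have ho51 : ∀ (x : Matrix (Fin 5) (Fin 5) ℂ)
        (y : Matrix (Fin 6) (Fin 6) ℂ × Matrix (Fin 1) (Fin 1) ℂ), N.primaryHom x *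
          (N.blockHom 1 N.evenProj).coprod (idempotentHom N.restIdempotent) y = 0 := fun x y => by
      simp [LinearMap.coprod_apply, Matrix.mul_add, o5e, o51]
    have ho15 : ∀ (x : Matrix (Fin 5) (Fin 5) ℂ)
        (y : Matrix (Fin 6) (Fin 6) ℂ × Matrix (Fin 1) (Fin 1) ℂ),
          (N.blockHom 1 N.evenProj).coprod (idempotentHom N.restIdempotent) y *
            N.primaryHom x = 0 := fun x y => by
      simp [LinearMap.coprod_apply, Matrix.add_mul, oe5, o15]
    have hm1 := coprod_map_mul me m1 oe1 o1e
    refine nonempty_algEquiv_of_linearMap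
      (f := N.primaryHom.coprod ((N.blockHom 1 N.evenProj).coprod
        (idempotentHom N.restIdempotent))) ?_ (coprod_map_mul m5 hm1 ho51 ho15)
      (coprod_injective m5 hm1 ho51 ho15 i5 (coprod_injective me m1 oe1 o1e ine i1)) ?_ ?_
    · simp [LinearMap.coprod_apply, idempotentHom_apply, restIdempotent, hz]
    · exact fun x => add_mem (t5 _) (add_mem (te _) (t1 _))
    · intro 𝓡 h
      refine N.incAlgebra_le (N.primaryUnit_mem_of_hom hn fun x => ?_)
        (N.blockUnit_mem_of_hom hn (.inl rfl) fun x => ?_) fun a b => ?_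
      · simpa [LinearMap.coprod_apply] using h (x, 0, 0)
      · simpa [LinearMap.coprod_apply] using h (0, x, 0)
      · simp [h0, blockUnit]
  · right
    have ino := N.blockHom_injective hn (.inr rfl) eo io h0
    have hoe1 : ∀ (x : Matrix (Fin 6) (Fin 6) ℂ)
        (y : Matrix (Fin 6) (Fin 6) ℂ × Matrix (Fin 1) (Fin 1) ℂ), N.blockHom 1 N.evenProj x *
          (N.blockHom (-1) N.oddProj).coprod (idempotentHom N.restIdempotent) y = 0 :=
      fun x y => by simp [LinearMap.coprod_apply, Matrix.mul_add, oeo, oe1]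
    have ho1e : ∀ (x : Matrix (Fin 6) (Fin 6) ℂ)
        (y : Matrix (Fin 6) (Fin 6) ℂ × Matrix (Fin 1) (Fin 1) ℂ),
          (N.blockHom (-1) N.oddProj).coprod (idempotentHom N.restIdempotent) y *
            N.blockHom 1 N.evenProj x = 0 :=
      fun x y => by simp [LinearMap.coprod_apply, Matrix.add_mul, ooe, o1e]
    have ho51 : ∀ (x : Matrix (Fin 5) (Fin 5) ℂ) (y : Matrix (Fin 6) (Fin 6) ℂ ×
        Matrix (Fin 6) (Fin 6) ℂ × Matrix (Fin 1) (Fin 1) ℂ), N.primaryHom x *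
          (N.blockHom 1 N.evenProj).coprod ((N.blockHom (-1) N.oddProj).coprod
            (idempotentHom N.restIdempotent)) y = 0 := fun x y => by
      simp [LinearMap.coprod_apply, Matrix.mul_add, o5e, o5o, o51]
    have ho15 : ∀ (x : Matrix (Fin 5) (Fin 5) ℂ) (y : Matrix (Fin 6) (Fin 6) ℂ ×
        Matrix (Fin 6) (Fin 6) ℂ × Matrix (Fin 1) (Fin 1) ℂ),
          (N.blockHom 1 N.evenProj).coprod ((N.blockHom (-1) N.oddProj).coprod
            (idempotentHom N.restIdempotent)) y * N.primaryHom x = 0 := fun x y => by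
      simp [LinearMap.coprod_apply, Matrix.add_mul, oe5, oo5, o15]
    have hm1 := coprod_map_mul mo m1 oo1 o1o
    have hi1 := coprod_injective mo m1 oo1 o1o ino i1
    have hm2 := coprod_map_mul me hm1 hoe1 ho1e
    refine nonempty_algEquiv_of_linearMap
      (f := N.primaryHom.coprod ((N.blockHom 1 N.evenProj).coprod
        ((N.blockHom (-1) N.oddProj).coprod (idempotentHom N.restIdempotent)))) ?_
      (coprod_map_mul m5 hm2 ho51 ho15)
      (coprod_injective m5 hm2 ho51 ho15 i5 (coprod_injective me hm1 hoe1 ho1e ine hi1)) ?_ ?_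
    · simp [LinearMap.coprod_apply, idempotentHom_apply, restIdempotent]
    · exact fun x => add_mem (t5 _) (add_mem (te _) (add_mem (tod _) (t1 _)))
    · intro 𝓡 h
      refine N.incAlgebra_le (N.primaryUnit_mem_of_hom hn fun x => ?_)
        (N.blockUnit_mem_of_hom hn (.inl rfl) fun x => ?_)
        (N.blockUnit_mem_of_hom hn (.inr rfl) fun x => ?_)
      · simpa [LinearMap.coprod_apply] using h (x, 0, 0, 0)
      · simpa [LinearMap.coprod_apply] using h (0, x, 0, 0)
      · simpa [LinearMap.coprod_apply] using h (0, 0, x, 0)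

end LoopNet

/-! ### The hexagon condition and its invariance in the main class -/

namespace LatinSquare

section Hexagon

variable {P : Type*}

/-- The hexagon condition for three families `E` of parallel classes, read in the order
`i, j, k`: if five sides of a hexagon around `p` close up properly, so does the sixth. -/
def Hexagonal (E : Fin 3 → P → P → Prop) (i j k : Fin 3) : Prop :=
  ∀ p x₁ x₂ x₃ x₄ x₅ x₆, E i x₁ p → E j x₂ p → E k x₃ p → E i x₄ p → E j x₅ p →
    E k x₁ x₂ → E i x₂ x₃ → E j x₃ x₄ → E k x₄ x₅ → E i x₅ x₆ → E j x₆ x₁ → E k x₆ p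

/-- Three parallel classes of lines, two lines of distinct classes meeting in one point. -/
structure IsNet (E : Fin 3 → P → P → Prop) : Prop where
  symm : ∀ i x y, E i x y → E i y x
  trans : ∀ i x y z, E i x y → E i y z → E i x z
  eq : ∀ i j, i ≠ j → ∀ x y, E i x y → E j x y → x = y
  exists_point : ∀ i j, i ≠ j → ∀ x y, ∃ z, E i z x ∧ E j z y

variable {E : Fin 3 → P → P → Prop} {i j k : Fin 3}

/-- Rebuild the two vertices next to the open corner so that the given condition applies; it then
forces them to coincide with `x₆` and `x₁`. -/
lemma Hexagonal.rotate (hE : IsNet E) (hij : i ≠ j) (hik : i ≠ k) (hjk : j ≠ k)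
    (h : Hexagonal E i j k) : Hexagonal E j k i := by
  intro p x₂ x₃ x₄ x₅ x₆ x₁ h2 h3 h4 h5 h6 h23 h34 h45 h56 h61 h12
  obtain ⟨y₁, hy1, hy12⟩ := hE.exists_point i k hik p x₂
  obtain ⟨y₆, hy56, hy61⟩ := hE.exists_point i j hij x₅ y₁
  have h6' := h p y₁ x₂ x₃ x₄ x₅ y₆ hy1 h2 h3 h4 h5 hy12 h23 h34 h45 (hE.symm _ _ _ hy56) hy61
  have e6 : y₆ = x₆ := hE.eq i k hik _ _ (hE.trans _ _ _ _ hy56 h56)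
    (hE.trans _ _ _ _ h6' (hE.symm _ _ _ h6))
  subst e6
  have e1 : y₁ = x₁ := hE.eq j k hjk _ _ (hE.trans _ _ _ _ (hE.symm _ _ _ hy61) h61)
    (hE.trans _ _ _ _ hy12 (hE.symm _ _ _ h12))
  exact e1 ▸ hy1

/-- The hexagon is traversed backwards. Replacing `x₃` by the point `y₃` that does lie on the right
line, the condition closes the new hexagon at `x₆`, and going back the vertices agree one by one. -/
lemma Hexagonal.swap (hE : IsNet E) (hij : i ≠ j) (hik : i ≠ k) (hjk : j ≠ k)
    (h : Hexagonal E i j k) : Hexagonal E j i k := by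
  intro p x₂ x₁ x₆ x₅ x₄ x₃ h2 h1 h6 h5 h4 h21 h16 h65 h54 h43 h32
  obtain ⟨y₃, hy3, hy32⟩ := hE.exists_point k i hik.symm p x₂
  obtain ⟨y₄, hy4, hy43⟩ := hE.exists_point i j hij p y₃
  obtain ⟨y₅, hy5, hy54⟩ := hE.exists_point j k hjk p y₄
  obtain ⟨y₆, hy65, hy61⟩ := hE.exists_point i j hij y₅ x₁
  have h6' := h p x₁ x₂ y₃ y₄ y₅ y₆ h1 h2 hy3 hy4 hy5 (hE.symm _ _ _ h21) (hE.symm _ _ _ hy32)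
    (hE.symm _ _ _ hy43) (hE.symm _ _ _ hy54) (hE.symm _ _ _ hy65) hy61
  have e6 : y₆ = x₆ := hE.eq j k hjk _ _ (hE.trans _ _ _ _ hy61 h16)
    (hE.trans _ _ _ _ h6' (hE.symm _ _ _ h6))
  subst e6
  have e5 : y₅ = x₅ := hE.eq i j hij _ _ (hE.trans _ _ _ _ (hE.symm _ _ _ hy65) h65)
    (hE.trans _ _ _ _ hy5 (hE.symm _ _ _ h5))
  subst e5
  have e4 : y₄ = x₄ := hE.eq k i hik.symm _ _ (hE.trans _ _ _ _ (hE.symm _ _ _ hy54) h54)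
    (hE.trans _ _ _ _ hy4 (hE.symm _ _ _ h4))
  subst e4
  have e3 : y₃ = x₃ := hE.eq j i hij.symm _ _ (hE.trans _ _ _ _ (hE.symm _ _ _ hy43) h43)
    (hE.trans _ _ _ _ hy32 (hE.symm _ _ _ h32))
  exact e3 ▸ hy3

/-- A rotation and a transposition generate all orders of the three classes. -/
lemma Hexagonal.of_distinct (hE : IsNet E) (h : Hexagonal E 0 1 2) (hij : i ≠ j) (hik : i ≠ k)
    (hjk : j ≠ k) : Hexagonal E i j k := by
  have h120 := h.rotate hE (by decide) (by decide) (by decide)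
  have h201 := h120.rotate hE (by decide) (by decide) (by decide)
  have h102 := h.swap hE (by decide) (by decide) (by decide)
  have h210 := h120.swap hE (by decide) (by decide) (by decide)
  have h021 := h201.swap hE (by decide) (by decide) (by decide)
  fin_cases i <;> fin_cases j <;> fin_cases k <;> first | assumption | simp at hij hik hjk

end Hexagon

/-! ### Latin squares as nets -/

variable {I S : Type*} (L : LatinSquare I S)

/-- Two points agree in one of the three components. -/
def Agree (i : Fin 3) (x y : L.Point) : Prop :=
  match i with
  | 0 => x.row = y.row
  | 1 => x.col = y.col
  | 2 => x.sym = y.sym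

/-- The point in a given row and column. -/
def point (r c : I) : L.Point := ⟨(r, c, L.entry r c), r, c, rfl⟩

@[simp] lemma point_row (r c : I) : (L.point r c).row = r := rfl
@[simp] lemma point_col (r c : I) : (L.point r c).col = c := rfl
@[simp] lemma point_sym (r c : I) : (L.point r c).sym = L.entry r c := rfl

variable {L} in
lemma Point.sym_eq (x : L.Point) : x.sym = L.entry x.row x.col := by
  obtain ⟨_, r, c, rfl⟩ := x; rfl

variable {L} in
lemma Point.eq_point (x : L.Point) : x = L.point x.row x.col := by
  obtain ⟨_, r, c, rfl⟩ := x; rfl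

lemma entry_left_injective (r : I) : Function.Injective (L.entry r) := fun _ c' h =>
  (L.row_existsUnique r (L.entry r c')).unique h rfl

lemma entry_right_injective (c : I) : Function.Injective fun r => L.entry r c := fun _ r' h =>
  (L.col_existsUnique c (L.entry r' c)).unique h rfl

lemma isNet_agree : IsNet L.Agree where
  symm i x y h := by
    fin_cases i <;> exact Eq.symm h
  trans i x y z h h' := by
    fin_cases i <;> exact Eq.trans h h'
  eq := by
    have h01 : ∀ x y : L.Point, x.row = y.row → x.col = y.col → x = y := fun x y h h' => by
      rw [x.eq_point, y.eq_point, h, h']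
    have h02 : ∀ x y : L.Point, x.row = y.row → x.sym = y.sym → x = y := fun x y h h' => by
      refine h01 x y h (L.entry_left_injective x.row ?_)
      rw [← x.sym_eq, h', y.sym_eq, h]
    have h12 : ∀ x y : L.Point, x.col = y.col → x.sym = y.sym → x = y := fun x y h h' => by
      refine h01 x y (L.entry_right_injective x.col ?_) h
      show L.entry x.row x.col = L.entry y.row x.col
      rw [← x.sym_eq, h', y.sym_eq, h]
    intro i j hij x y hi hj
    fin_cases i <;> fin_cases j <;>
      first
      | exact absurd rfl hij
      | exact h01 x y hi hj
      | exact h01 x y hj hi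
      | exact h02 x y hi hj
      | exact h02 x y hj hi
      | exact h12 x y hi hj
      | exact h12 x y hj hi
  exists_point := by
    have h01 : ∀ x y : L.Point, ∃ z : L.Point, z.row = x.row ∧ z.col = y.col := fun x y =>
      ⟨L.point x.row y.col, rfl, rfl⟩
    have h02 : ∀ x y : L.Point, ∃ z : L.Point, z.row = x.row ∧ z.sym = y.sym := fun x y =>
      let ⟨c, hc, _⟩ := L.row_existsUnique x.row y.sym
      ⟨L.point x.row c, rfl, hc⟩
    have h12 : ∀ x y : L.Point, ∃ z : L.Point, z.col = x.col ∧ z.sym = y.sym := fun x y =>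
      let ⟨r, hr, _⟩ := L.col_existsUnique x.col y.sym
      ⟨L.point r x.col, rfl, hr⟩
    intro i j hij x y
    fin_cases i <;> fin_cases j <;>
      first
      | exact absurd rfl hij
      | exact h01 x y
      | exact (h01 y x).imp fun _ => And.symm
      | exact h02 x y
      | exact (h02 y x).imp fun _ => And.symm
      | exact h12 x y
      | exact (h12 y x).imp fun _ => And.symm

variable {L}

lemma Hexagonal.of_isotopic {I' S' : Type*} {L' : LatinSquare I' S'} (h : Isotopic L L')
    (hL' : Hexagonal L'.Agree 0 1 2) : Hexagonal L.Agree 0 1 2 := by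
  obtain ⟨σr, σc, σe, hσ⟩ := h
  let f : L.Point → L'.Point := fun x => L'.point (σr x.row) (σc x.col)
  have hf : ∀ i x y, L'.Agree i (f x) (f y) ↔ L.Agree i x y := by
    intro i x y
    fin_cases i
    · exact σr.injective.eq_iff
    · exact σc.injective.eq_iff
    · show L'.entry _ _ = L'.entry _ _ ↔ x.sym = y.sym
      rw [hσ, hσ, σe.injective.eq_iff, x.sym_eq, y.sym_eq]
  intro p x₁ x₂ x₃ x₄ x₅ x₆ h1 h2 h3 h4 h5 h12 h23 h34 h45 h56 h61
  simp only [← hf] at *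
  exact hL' _ _ _ _ _ _ _ h1 h2 h3 h4 h5 h12 h23 h34 h45 h56 h61

lemma agree_iff_components {J : Type*} {L : LatinSquare J J} (i : Fin 3) (x y : L.Point) :
    L.Agree i x y ↔ components x.1 i = components y.1 i := by
  fin_cases i <;> rfl

lemma components_permuteTriple {J : Type*} (σ : Equiv.Perm (Fin 3)) (x : J × J × J) (i : Fin 3) :
    components (permuteTriple σ x) i = components x (σ.symm i) := by
  fin_cases i <;> rfl

lemma Hexagonal.of_conjugate {J : Type*} {L M : LatinSquare J J} (h : Conjugate L M)
    (hL : Hexagonal L.Agree 0 1 2) : Hexagonal M.Agree 0 1 2 := by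
  obtain ⟨σ, hσ⟩ := h
  have hex : ∀ x : M.Point, ∃ y : L.Point, permuteTriple σ y.1 = x.1 := fun x => by
    obtain ⟨y, hy, h⟩ := hσ.le x.2
    exact ⟨⟨y, hy⟩, h⟩
  choose f hf using hex
  have hf' : ∀ i x y, L.Agree (σ.symm i) (f x) (f y) ↔ M.Agree i x y := fun i x y => by
    rw [agree_iff_components, agree_iff_components, ← hf x, ← hf y, components_permuteTriple,
      components_permuteTriple]
  have key := hL.of_distinct L.isNet_agree (i := σ.symm 0) (j := σ.symm 1) (k := σ.symm 2)
    (by simp) (by simp) (by simp)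
  intro p x₁ x₂ x₃ x₄ x₅ x₆ h1 h2 h3 h4 h5 h12 h23 h34 h45 h56 h61
  simp only [← hf'] at *
  exact key _ _ _ _ _ _ _ h1 h2 h3 h4 h5 h12 h23 h34 h45 h56 h61

end LatinSquare

/-! ### Bol loops satisfy the hexagon condition -/

section Bol

variable {Q : Type*} [Mul Q]

/-- Right Bol loops satisfy the hexagon condition. -/
lemma RightBolAxiom.hexagon (hQ : IsLoop Q) (hB : RightBolAxiom Q) {r₀ c₀ r c r₁ c₁ : Q}
    (h1 : r₀ * c = r * c₀) (h2 : r * c₁ = r₀ * c₀) (h3 : r₀ * c₁ = r₁ * c₀) :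
    r₁ * c = r₀ * c₀ := by
  obtain ⟨e, he⟩ := hQ.exists_identity
  obtain ⟨b, hb, -⟩ := hQ.existsUnique_right c₁ e
  -- Right inverse property, with `b` the right inverse of `c₁`: by the Bol identity both sides
  -- agree after right multiplication by `c₁`.
  have hinv : ∀ u, (u * c₁) * b = u := fun u => by
    refine (hQ.existsUnique_left c₁ (u * c₁)).unique ?_ rfl
    rw [hB c₁ b u, hb, (he c₁).2]
  -- This expresses `c` through `c₀` and `c₁` alone, so that it can be applied to `r₁` as well as to
  -- `r₀`.
  have hc : (c₀ * b) * c₀ = c := by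
    refine (hQ.existsUnique_right r₀ (r * c₀)).unique ?_ h1
    rw [← hB, ← h2, hinv]
  rw [← hc, ← hB, ← h3, hinv]

/-- Left Bol loops satisfy the mirror image of the hexagon condition. -/
lemma LeftBolAxiom.hexagon (hQ : IsLoop Q) (hB : LeftBolAxiom Q) {r₀ c₀ r c r₁ c₁ : Q}
    (h1 : c * r₀ = c₀ * r) (h2 : c₁ * r = c₀ * r₀) (h3 : c₁ * r₀ = c₀ * r₁) :
    c * r₁ = c₀ * r₀ := by
  obtain ⟨e, he⟩ := hQ.exists_identity
  obtain ⟨b, hb, -⟩ := hQ.existsUnique_left c₁ e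
  have hinv : ∀ u, b * (c₁ * u) = u := fun u => by
    refine (hQ.existsUnique_right c₁ (c₁ * u)).unique ?_ rfl
    rw [hB c₁ b u, hb, (he c₁).1]
  have hc : c₀ * (b * c₀) = c := by
    refine (hQ.existsUnique_left r₀ (c₀ * r)).unique ?_ h1
    rw [← hB, ← h2, hinv]
  rw [← hc, ← hB, ← h3, hinv]

open LatinSquare in
lemma IsBolLoop.hexagonal (hQ : IsBolLoop Q) :
    Hexagonal (cayleyTable hQ.toIsQuasigroup).Agree 0 1 2 := by
  have hs : ∀ x : (cayleyTable hQ.toIsQuasigroup).Point, x.sym = x.row * x.col := Point.sym_eq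
  rcases hQ.bol with hB | hB
  · intro p x₁ x₂ x₃ x₄ x₅ x₆ h1 h2 h3 h4 h5 h12 h23 h34 h45 h56 h61
    simp only [Agree, hs] at *
    -- The last vertex has the row of `x₅` and the column of `x₁`.
    rw [h61, ← h56]
    refine hB.hexagon hQ.toIsLoop (r := x₂.row) (c₁ := x₃.col) ?_ ?_ ?_
    · rw [← h1, h12, h2]
    · rw [h23, h3]
    · rw [h34, ← h4, h45, h5]
  -- The left Bol identity mirrors the right one, with rows and columns exchanged.
  · refine Hexagonal.swap (isNet_agree _) (by decide) (by decide) (by decide) ?_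
    intro p x₁ x₂ x₃ x₄ x₅ x₆ h1 h2 h3 h4 h5 h12 h23 h34 h45 h56 h61
    simp only [Agree, hs] at *
    rw [h61, ← h56]
    refine hB.hexagon hQ.toIsLoop (r := x₂.col) (c₁ := x₃.row) ?_ ?_ ?_
    · rw [← h1, h12, h2]
    · rw [h23, h3]
    · rw [h34, ← h4, h45, h5]

end Bol

/-! ### Loop coordinates of a Latin square at a base point -/

namespace LatinSquare

variable {I S : Type*} (L : LatinSquare I S)

/-- The column of a given row in which a symbol occurs. -/
noncomputable def colOf (r : I) (s : S) : I := (L.row_existsUnique r s).choose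

/-- The row of a given column in which a symbol occurs. -/
noncomputable def rowOf (c : I) (s : S) : I := (L.col_existsUnique c s).choose

@[simp] lemma entry_colOf (r : I) (s : S) : L.entry r (L.colOf r s) = s :=
  (L.row_existsUnique r s).choose_spec.1

@[simp] lemma entry_rowOf (c : I) (s : S) : L.entry (L.rowOf c s) c = s :=
  (L.col_existsUnique c s).choose_spec.1

/-- The coordinates of points with respect to the base point `p`. -/
def pointCoord (p : L.Point) : Fin 3 → L.Point → S :=
  ![fun x => L.entry x.row p.col, fun x => L.entry p.row x.col, Point.sym]

lemma pointCoord_eq_iff (p : L.Point) (i : Fin 3) (x y : L.Point) :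
    L.pointCoord p i x = L.pointCoord p i y ↔ L.Agree i x y := by
  fin_cases i
  · exact (L.entry_right_injective p.col).eq_iff
  · exact (L.entry_left_injective p.row).eq_iff
  · exact Iff.rfl

/-- The points of the lines through the base point `p`. -/
noncomputable def basePoint (p : L.Point) : Fin 3 → S → L.Point :=
  ![fun s => L.point p.row (L.colOf p.row s), fun s => L.point (L.rowOf p.col s) p.col,
    fun s => L.point (L.rowOf p.col s) (L.colOf (L.rowOf p.col s) p.sym)]

lemma exists_pointCoord_eq (p : L.Point) (i : Fin 3) (s : S) :
    ∃ x, L.pointCoord p i x = s := by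
  fin_cases i
  · exact ⟨L.point (L.rowOf p.col s) p.col, by simp [pointCoord]⟩
  · exact ⟨L.point p.row (L.colOf p.row s), by simp [pointCoord]⟩
  · exact ⟨L.point p.row (L.colOf p.row s), by simp [pointCoord]⟩

/-- The net of a Latin square with the hexagon condition, with respect to a base point. -/
noncomputable def loopNet (hL : Hexagonal L.Agree 0 1 2) (p : L.Point) : LoopNet L.Point S where
  e := p.sym
  inv s := L.entry p.row (L.colOf (L.rowOf p.col s) p.sym)
  coord := L.pointCoord p
  base := L.basePoint p
  inv_inv s := by
    set r := L.rowOf p.col s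
    set c₁ := L.colOf r p.sym
    set r₁ := L.rowOf p.col (L.entry p.row c₁)
    -- The vertices are the points labelled `s` on the three lines, those labelled `inv s` on the
    -- first two, and a sixth in the row of the fifth and the column of the first. The hexagon
    -- condition puts the sixth on the third line, so it is the point labelled `inv s` there; its
    -- column returns `s`.
    have h := hL p (L.point p.row (L.colOf p.row s)) (L.point r p.col) (L.point r c₁)
      (L.point p.row c₁) (L.point r₁ p.col) (L.point r₁ (L.colOf p.row s)) rfl rfl
      (by simp [Agree, c₁]) rfl rfl (by simp [Agree, r]) rfl rfl (by simp [Agree, r₁]) rfl rfl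
    have h' : L.colOf r₁ p.sym = L.colOf p.row s :=
      L.entry_left_injective r₁ ((L.entry_colOf r₁ p.sym).trans h.symm)
    rw [h', entry_colOf]
  coord_injective i j hij x y hi hj :=
    L.isNet_agree.eq i j hij x y ((L.pointCoord_eq_iff p i x y).1 hi)
      ((L.pointCoord_eq_iff p j x y).1 hj)
  coord_surjective i j hij s t := by
    obtain ⟨x, rfl⟩ := L.exists_pointCoord_eq p i s
    obtain ⟨y, rfl⟩ := L.exists_pointCoord_eq p j t
    obtain ⟨z, hz⟩ := L.isNet_agree.exists_point i j hij x y
    exact ⟨z, (L.pointCoord_eq_iff p i z x).2 hz.1, (L.pointCoord_eq_iff p j z y).2 hz.2⟩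
  coord_base i j s := by
    fin_cases i <;> fin_cases j <;> simp [pointCoord, basePoint, ← Point.sym_eq]

/-- Inclusion and exclusion: points agreeing in two components are equal, so the diagonal is the
only overlap of the three agreement relations and is subtracted three times instead of once. -/
lemma relationMatrix_apply (i : Fin 5) (x y : L.Point) {d : Fin 3 → ℂ}
    (hd : ∀ j, (L.Agree j x y → d j = 1) ∧ (¬ L.Agree j x y → d j = 0)) :
    L.relationMatrix i x y = (![if x = y then 1 else 0, d 0 - (if x = y then 1 else 0),
      d 1 - (if x = y then 1 else 0), d 2 - (if x = y then 1 else 0),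
      1 - d 0 - d 1 - d 2 + 2 * (if x = y then 1 else 0)] : Fin 5 → ℂ) i := by
  have h0 := hd 0
  have h1 := hd 1
  have h2 := hd 2
  have e01 := L.isNet_agree.eq 0 1 (by decide) x y
  have e02 := L.isNet_agree.eq 0 2 (by decide) x y
  have e12 := L.isNet_agree.eq 1 2 (by decide) x y
  simp only [Agree] at h0 h1 h2 e01 e02 e12
  by_cases hxy : x = y
  · subst hxy
    fin_cases i <;> simp [relationMatrix, Related, h0, h1, h2]
    norm_num
  · by_cases a0 : x.row = y.row
    · have a1 : x.col ≠ y.col := fun h => hxy (e01 a0 h)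
      have a2 : x.sym ≠ y.sym := fun h => hxy (e02 a0 h)
      fin_cases i <;> simp [relationMatrix, Related, hxy, a0, a1, a2, h0.1 a0, h1.2 a1, h2.2 a2]
    · by_cases a1 : x.col = y.col
      · have a2 : x.sym ≠ y.sym := fun h => hxy (e12 a1 h)
        fin_cases i <;> simp [relationMatrix, Related, hxy, a0, a1, a2, h0.2 a0, h1.1 a1, h2.2 a2]
      · by_cases a2 : x.sym = y.sym
        · fin_cases i <;>
            simp [relationMatrix, Related, hxy, a0, a1, a2, h0.2 a0, h1.2 a1, h2.1 a2]
        · fin_cases i <;>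
            simp [relationMatrix, Related, hxy, a0, a1, a2, h0.2 a0, h1.2 a1, h2.2 a2]

end LatinSquare

/-! ### The Terwilliger algebra as the algebra of the net -/

namespace LoopNet

open Matrix

variable {X S : Type*} (N : LoopNet X S) [DecidableEq X] [DecidableEq S] [Fintype X] [Fintype S]

lemma lineMatrix_mul_transpose (j : Fin 3) :
    N.lineMatrix j * (N.lineMatrix j)ᵀ =
      of fun x y => if N.coord j y = N.coord j x then 1 else 0 := by
  rw [lineMatrix_mul]; rfl

end LoopNet

namespace LatinSquare

open Matrix

variable {I S : Type*} [Finite I] [Fintype S] [DecidableEq S] (L : LatinSquare I S)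
  (hL : Hexagonal L.Agree 0 1 2) (p : L.Point)

lemma relationMatrix_eq (i : Fin 5) :
    L.relationMatrix i = (![1,
      (L.loopNet hL p).lineMatrix 0 * ((L.loopNet hL p).lineMatrix 0)ᵀ - 1,
      (L.loopNet hL p).lineMatrix 1 * ((L.loopNet hL p).lineMatrix 1)ᵀ - 1,
      (L.loopNet hL p).lineMatrix 2 * ((L.loopNet hL p).lineMatrix 2)ᵀ - 1,
      vecMulVec 1 1 - (L.loopNet hL p).lineMatrix 0 * ((L.loopNet hL p).lineMatrix 0)ᵀ
        - (L.loopNet hL p).lineMatrix 1 * ((L.loopNet hL p).lineMatrix 1)ᵀ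
        - (L.loopNet hL p).lineMatrix 2 * ((L.loopNet hL p).lineMatrix 2)ᵀ
        + (2 : ℂ) • 1] : Fin 5 → Matrix L.Point L.Point ℂ) i := by
  ext x y
  rw [L.relationMatrix_apply i x y (d := fun j =>
    ((L.loopNet hL p).lineMatrix j * ((L.loopNet hL p).lineMatrix j)ᵀ) x y) fun j => ?_]
  · fin_cases i <;> simp [Matrix.one_apply]
  · have h : (L.loopNet hL p).coord j y = (L.loopNet hL p).coord j x ↔ L.Agree j x y :=
      eq_comm.trans (L.pointCoord_eq_iff p j x y)
    rw [LoopNet.lineMatrix_mul_transpose]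
    exact ⟨fun h' => if_pos (h.2 h'), fun h' => if_neg (mt h.1 h')⟩

lemma dualIdempotent_eq (i : Fin 5) :
    L.dualIdempotent p i = diagonal ((L.loopNet hL p).classVec i) := by
  rw [dualIdempotent]
  congr 1
  ext x
  have hcoord : ∀ j, L.pointCoord p j p = p.sym := fun j => by
    fin_cases j <;> simp [pointCoord, Point.sym_eq]
  have hp : (L.loopNet hL p).base 0 (L.loopNet hL p).e = p :=
    ((L.loopNet hL p).eq_base_e (i := 0) (j := 1) (by decide) (hcoord 0) (hcoord 1)).symm
  have hpt : (L.loopNet hL p).pointVec x = if p = x then 1 else 0 := by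
    rw [LoopNet.pointVec, hp, Pi.single_apply]
    simp only [eq_comm]
  rw [L.relationMatrix_apply i p x (d := fun j => (L.loopNet hL p).lineVec j x) fun j => ?_]
  · fin_cases i <;> simp [LoopNet.classVec, hpt]
  · have h : (L.loopNet hL p).coord j x = (L.loopNet hL p).e ↔ L.Agree j p x := by
      rw [← L.pointCoord_eq_iff p, hcoord]
      exact eq_comm
    exact ⟨fun h' => if_pos (h.2 h'), fun h' => if_neg (mt h.1 h')⟩

/-- Each parallel class contributes `A_j + 1 = lineMatrix * lineMatrixᵀ`, and each line through the
base point contributes `E*_j + E*_0 = baseMatrix * baseMatrixᵀ`. The remaining generators are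
polynomials in these. -/
lemma terwilligerAlgebra_eq_incAlgebra :
    L.terwilligerAlgebra p = (L.loopNet hL p).incAlgebra := by
  set N := L.loopNet hL p with hN
  have hrel := L.relationMatrix_eq hL p
  have hdual := L.dualIdempotent_eq hL p
  rw [← hN] at hrel hdual
  apply le_antisymm
  · have hD : ∀ j, N.lineMatrix j * (N.lineMatrix j)ᵀ - 1 ∈ N.incAlgebra := fun j =>
      sub_mem (N.inc_mul_transpose_mem (.inr j)) (one_mem _)
    refine Algebra.adjoin_le (Set.union_subset ?_ ?_)
    · rintro _ ⟨i, rfl⟩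
      rw [SetLike.mem_coe, hrel]
      fin_cases i
      · exact one_mem _
      · exact hD 0
      · exact hD 1
      · exact hD 2
      · exact add_mem (sub_mem (sub_mem (sub_mem N.vecMulVec_one_mem
          (N.inc_mul_transpose_mem (.inr 0))) (N.inc_mul_transpose_mem (.inr 1)))
          (N.inc_mul_transpose_mem (.inr 2))) (Subalgebra.smul_mem _ (one_mem _) 2)
    · rintro _ ⟨i, rfl⟩
      rw [SetLike.mem_coe, hdual]
      exact N.diagonal_classVec_mem i
  · have hA : ∀ i, L.relationMatrix i ∈ L.terwilligerAlgebra p := fun i =>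
      Algebra.subset_adjoin (.inl ⟨i, rfl⟩)
    have hE : ∀ i, L.dualIdempotent p i ∈ L.terwilligerAlgebra p := fun i =>
      Algebra.subset_adjoin (.inr ⟨i, rfl⟩)
    have hbase : ∀ i k, N.classVec k = N.lineVec i - N.pointVec →
        N.baseMatrix i * (N.baseMatrix i)ᵀ ∈ L.terwilligerAlgebra p := fun i k h => by
      have h' := add_mem (hE k) (hE 0)
      rw [hdual, hdual, h, diagonal_add] at h'
      have e : (fun x => (N.lineVec i - N.pointVec) x + N.classVec 0 x) = N.lineVec i := by
        ext x
        simp [LoopNet.classVec]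
      rw [N.baseMatrix_mul_transpose]
      rwa [e] at h'
    have hline : ∀ j k, L.relationMatrix k = N.lineMatrix j * (N.lineMatrix j)ᵀ - 1 →
        N.lineMatrix j * (N.lineMatrix j)ᵀ ∈ L.terwilligerAlgebra p := fun j k h => by
      have h' := add_mem (hA k) (one_mem (L.terwilligerAlgebra p))
      rwa [h, sub_add_cancel] at h'
    refine Algebra.adjoin_le ?_
    rintro _ ⟨i | j, rfl⟩
    · fin_cases i
      · exact hbase 0 1 rfl
      · exact hbase 1 2 rfl
      · exact hbase 2 3 rfl
    · fin_cases j
      · exact hline 0 1 (hrel 1)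
      · exact hline 1 2 (hrel 2)
      · exact hline 2 3 (hrel 3)

end LatinSquare

theorem mainTheorem4 {Q : Type*} [Mul Q] [Finite Q] (hQ : IsBolLoop Q) (hcard : 5 ≤ Nat.card Q)
    {I : Type*} {S : Type*} [Finite I] (L : LatinSquare I S)
    (hL : LatinSquare.MainClassEquivalent L (cayleyTable hQ.toIsQuasigroup)) (p : L.Point) :
    Nonempty (L.terwilligerAlgebra p ≃ₐ[ℂ]
      (Matrix (Fin 5) (Fin 5) ℂ × Matrix (Fin 6) (Fin 6) ℂ × Matrix (Fin 1) (Fin 1) ℂ)) ∨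
    Nonempty (L.terwilligerAlgebra p ≃ₐ[ℂ]
      (Matrix (Fin 5) (Fin 5) ℂ × Matrix (Fin 6) (Fin 6) ℂ × Matrix (Fin 6) (Fin 6) ℂ ×
        Matrix (Fin 1) (Fin 1) ℂ)) := by
  obtain ⟨M, hM, hLM⟩ := hL
  have hex : LatinSquare.Hexagonal L.Agree 0 1 2 :=
    (hQ.hexagonal.of_conjugate hM).of_isotopic hLM
  -- Finiteness and size of the symbol set come from the bijection of symbols in the isotopy.
  obtain ⟨-, -, σ, -⟩ := hLM
  let _ : Finite S := Finite.of_equiv Q σ.symm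
  let _ : Fintype S := Fintype.ofFinite S
  let _ : DecidableEq S := Classical.decEq S
  have hn : 5 ≤ Fintype.card S := by
    rwa [← Nat.card_eq_fintype_card, Nat.card_congr σ]
  rw [L.terwilligerAlgebra_eq_incAlgebra hex p]
  exact (L.loopNet hex p).nonempty_incAlgebra_algEquiv hn
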